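/- Let $Q$ be a probability measure on $[0,\infty)$ which either is the Dirac measure $\delta_1$, or has a density $q$ on $(0,\infty)$ that is strictly positive and continuously differentiable, with $q(y)\to 0$ and $q'(y)\to 0$ both as $y\to +0$ and as $y\to+\infty$, and with $y\,q(y)\to 0$ as $y\to+\infty$. For each $d\ge 1$ let $P^d$ be the law of a random vector $X_0^d$ in $\mathbb{R}^d$ such that $X_0^d\mid Y\sim N_d(0,Y I_d)$ with $Y\sim Q$, and let $p^d$ be its Lebesgue density, $p^d(x)=\int \phi_d(x;0,yI_d)\,Q(\mathrm{d}y)$, where $\phi_d(\cdot\,;0,yI_d)$ is the density of $N_d(0,yI_d)$. Let $\Gamma^d$ be any probability measure on $\mathbb{R}^d$ that is symmetric about the origin, i.e. $\Gamma^d(A)=\Gamma^d(-A)$ for all Borel sets $A$. Let $(X^d_m)_{m\ge 0}$ be the stationary random-walk Metropolis chain with target $P^d$ and increment law $\Gamma^d$: $X^d_0\sim P^d$, the increments $W^d_1,W^d_2,\dots\sim\Gamma^d$ are i.i.d. and independent of $X_0^d$, and for $m\ge 1$, given $X_0^d$, all the increments and the earlier accept/reject decisions, $X^d_m=X^d_{m-1}+W^d_m$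 with probability $\min\{1,p^d(X^d_{m-1}+W^d_m)/p^d(X^d_{m-1})\}$ and $X^d_m=X^d_{m-1}$ otherwise. Let $\alpha(d)\ge 0$ satisfy $\alpha(d)/d^{2-\varepsilon}\to 0$ as $d\to\infty$ for some $\varepsilon>0$, and put $Z^d_t=\|X^d_{[t\alpha(d)]}\|^2/d$ for $t\ge 0$, where $\|\cdot\|$ is the Euclidean norm and $[\cdot]$ the integer part. Then for every $T\ge 0$, $$\sup_{0\le s,t\le T}|Z^d_t-Z^d_s|\to 0\quad\text{in probability as } d\to\infty .$$ -/

import Mathlib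

open MeasureTheory ProbabilityTheory Filter Topology Set
open scoped ENNReal NNReal Pointwise

noncomputable section

/-- The mixing law `Q` has a probability density `q` on `(0, ∞)` which is strictly positive and
continuously differentiable there, such that `q` and `q'` vanish at `+0` and at `+∞`, and
`y * q y` vanishes at `+∞`. -/
structure HasRegularDensity (Q : Measure ℝ) (q : ℝ → ℝ) : Prop where
  eq_withDensity :
    Q = (volume.restrict (Ioi (0 : ℝ))).withDensity (fun y => ENNReal.ofReal (q y))
  pos : ∀ y, 0 < y → 0 < q y
  contDiffOn : ContDiffOn ℝ 1 q (Ioi 0)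
  tendsto_zero : Tendsto q (𝓝[>] 0) (𝓝 0)
  tendsto_atTop : Tendsto q atTop (𝓝 0)
  deriv_tendsto_zero : Tendsto (deriv q) (𝓝[>] 0) (𝓝 0)
  deriv_tendsto_atTop : Tendsto (deriv q) atTop (𝓝 0)
  mul_tendsto_atTop : Tendsto (fun y => y * q y) atTop (𝓝 0)

/-- The standing assumption on the mixing law: it is the Dirac measure at `1`, or it has a
density that is regular in the sense above. -/
def IsAdmissibleMixing (Q : Measure ℝ) : Prop :=
  Q = Measure.dirac 1 ∨ ∃ q : ℝ → ℝ, HasRegularDensity Q q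

/-- The target `P^d`: the law of `X` where `Y ∼ Q` and, given `Y`, `X ∼ N_d(0, Y I_d)`. It is
realised as the law of `√Y • G` with `Y ∼ Q` and `G ∼ N_d(0, I_d)` independent. -/
def targetLaw (Q : Measure ℝ) (d : ℕ) : Measure (EuclideanSpace ℝ (Fin d)) :=
  (Q.prod (stdGaussian (EuclideanSpace ℝ (Fin d)))).map (fun z => Real.sqrt z.1 • z.2)

/-- The Lebesgue density `p^d` of the target: `p^d(x) = ∫ φ_d(x; 0, y I_d) Q(dy)`, where
`φ_d(x; 0, y I_d)` is the product of the `N(0, y)` densities at the coordinates of `x`. -/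
def targetDensity (Q : Measure ℝ) (d : ℕ) (x : EuclideanSpace ℝ (Fin d)) : ℝ≥0∞ :=
  ∫⁻ y, ∏ i, gaussianPDF 0 y.toNNReal (x i) ∂Q

/-- The Metropolis acceptance probability `min {1, p^d(x') / p^d(x)}`. -/
def acceptProb (Q : Measure ℝ) (d : ℕ) (x x' : EuclideanSpace ℝ (Fin d)) : ℝ :=
  (min 1 (targetDensity Q d x' / targetDensity Q d x)).toReal

/-- `X` is the stationary random-walk Metropolis chain with target `P^d` and increment law `Γ`,
driven by the proposals `W` and the acceptance variables `U`: the start `X 0 ∼ P^d`, the i.i.d.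
proposals `W m ∼ Γ` and the i.i.d. variables `U m`, uniform on `[0, 1]`, are all independent, and
the proposal `X m + W m` is accepted exactly when `U m ≤ min {1, p^d(X m + W m) / p^d(X m)}`.
(`W m` and `U m` drive the step from time `m` to time `m + 1`.) -/
structure IsStationaryRWM (Q : Measure ℝ) (d : ℕ) (Γ : Measure (EuclideanSpace ℝ (Fin d)))
    {Ω : Type*} [MeasurableSpace Ω] (μ : Measure Ω)
    (X W : ℕ → Ω → EuclideanSpace ℝ (Fin d)) (U : ℕ → Ω → ℝ) : Prop where
  law_init : HasLaw (X 0) (targetLaw Q d) μ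
  law_increment : ∀ m, HasLaw (W m) Γ μ
  law_uniform : ∀ m, HasLaw (U m) (volume.restrict (Icc (0 : ℝ) 1)) μ
  indep_init : IndepFun (X 0) (fun ω m => (W m ω, U m ω)) μ
  indep_steps : iIndepFun (fun m ω => (W m ω, U m ω)) μ
  indep_increment_uniform : ∀ m, IndepFun (W m) (U m) μ
  step : ∀ m, ∀ᵐ ω ∂μ, X (m + 1) ω =
    if U m ω ≤ acceptProb Q d (X m ω) (X m ω + W m ω) then X m ω + W m ω else X m ω

/-- The scaled squared-norm path `Z_t = ‖x_{[t a]}‖² / d` of a sequence `x` in `ℝ^d`. -/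
def scaledSqNorm {d : ℕ} (a : ℝ) (x : ℕ → EuclideanSpace ℝ (Fin d)) (t : ℝ) : ℝ :=
  ‖x ⌊t * a⌋₊‖ ^ 2 / (d : ℝ)

/-- `sup_{0 ≤ s, t ≤ T} |z t - z s|`, with values in `[0, ∞]`. -/
def supOscillation (z : ℝ → ℝ) (T : ℝ) : ℝ≥0∞ :=
  ⨆ s ∈ Icc 0 T, ⨆ t ∈ Icc 0 T, ENNReal.ofReal |z t - z s|

end

/-!
The chain is observed through the bounded function `h x = (1 + ‖x‖ ^ 2 / d)⁻¹` of the scaled squared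
norm, and a single step changes `h` by `O(1 / d)` in mean square, whatever the increment law. Only
two properties of the chain enter: it is stationary and reversible, and its target is rotation
invariant and tight on the scale `‖x‖ ^ 2 / d`.

*One step.* By reversibility, moves which increase the norm contribute as much to the mean square of
the change of `h` as those which decrease it. A decreasing move satisfies
`‖x‖ ^ 2 - ‖x + w‖ ^ 2 ≤ ⟪x, w / ‖w‖⟫ ^ 2`, and a component of a rotation invariant `x` in a direction
independent of `x` is of size `‖x‖ / √d`. Hence a long increment helps only on a rare event, the
acceptance probability may be bounded by `1`, and the mean square is at most `C / d ^ 2`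
(`norm_sq_sub_norm_add_sq_le`, `lintegral_inner_pow_four_mul_le`,
`integral_sq_invNormObservable_step_le`). The weight in `h` makes this uniform in the mixing variable,
which need not have moments.

*Many steps.* For a stationary reversible chain the mean square displacement over `k` steps is at most
`k` times that over one step, a consequence of the transition operator being a self-adjoint
contraction (`autocorrelation_zero_sub_le`, `IsReversibleRecursion.integral_sq_sub_le`). Dyadic
chaining turns this into a bound for the maximum over `n` steps at the cost of a factor of order
`log ^ 2 n` (`measure_exists_le_abs_sub_zero_le`). As `n` is `O(d ^ (2 - ε))`, the resulting bound
`n * log ^ 2 n / d ^ 2` tends to zero (`exists_dyadic_time_scale`).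

*Conclusion.* The initial value of `‖x‖ ^ 2 / d` lies in a fixed bounded set with probability close
to one (`targetLaw_norm_sq_gt_le`), and there closeness of `h` gives closeness of `‖x‖ ^ 2 / d`
(`abs_sub_le_of_abs_inv_sub_lt`). The mixing law enters through `0 < Y` almost surely, which makes
`targetDensity` a genuine density of `targetLaw`, so that detailed balance holds
(`targetLaw_eq_withDensity`, `map_metropolisUpdate_symm`), and through its tightness.
-/

/-! ### Dyadic chaining -/

/-- The sum over the dyadic scales `2 ^ l ≤ 2 ^ N` of the squared increments of the sequence `a`
between consecutive multiples of `2 ^ l` in `[0, 2 ^ N]`. -/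
def dyadicEnergy (N : ℕ) (a : ℕ → ℝ) : ℝ :=
  ∑ l ∈ Finset.range (N + 1), ∑ j ∈ Finset.range (2 ^ (N - l)),
    (a ((j + 1) * 2 ^ l) - a (j * 2 ^ l)) ^ 2

theorem abs_sub_zero_le_sum_of_dyadic (N : ℕ) : ∀ (a b : ℕ → ℝ),
    (∀ l ≤ N, ∀ j < 2 ^ (N - l), |a ((j + 1) * 2 ^ l) - a (j * 2 ^ l)| ≤ b l) →
    ∀ m ≤ 2 ^ N, |a m - a 0| ≤ ∑ l ∈ Finset.range (N + 1), b l := by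
  induction N with
  | zero =>
    intro a b h m hm
    have h0 := h 0 le_rfl 0 (by simp)
    simp only [zero_add, pow_zero, mul_one] at h0
    have hb : 0 ≤ b 0 := (abs_nonneg _).trans h0
    have : m = 0 ∨ m = 1 := by simp at hm; omega
    rcases this with rfl | rfl <;> simp [hb, h0]
  | succ N ih =>
    intro a b h m hm
    have key := ih (fun j => a (2 * j)) (fun l => b (l + 1)) (fun l hl j hj => by
      have := h (l + 1) (by omega) j (by simpa using hj)
      convert this using 4 <;> ring_nf) (m / 2) (by rw [pow_succ] at hm; omega)
    have h0 := h 0 (Nat.zero_le _) (2 * (m / 2))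
    simp only [mul_zero] at key
    rw [Finset.sum_range_succ']
    have hb : 0 ≤ b 0 := (abs_nonneg _).trans (h 0 (Nat.zero_le _) 0 (by positivity))
    rcases Nat.even_or_odd' m with ⟨k, hk | hk⟩
    · have : 2 * (m / 2) = m := by omega
      rw [this] at key
      linarith
    · have e : 2 * (m / 2) + 1 = m := by omega
      have h1 := h0 (by simp only [Nat.sub_zero]; omega)
      simp only [pow_zero, mul_one, e] at h1
      have := abs_sub_le (a m) (a (2 * (m / 2))) (a 0)
      linarith

theorem sq_sub_zero_le_dyadicEnergy {N m : ℕ} (a : ℕ → ℝ) (hm : m ≤ 2 ^ N) :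
    (a m - a 0) ^ 2 ≤ (N + 1) * dyadicEnergy N a := by
  set e : ℕ → ℝ := fun l => ∑ j ∈ Finset.range (2 ^ (N - l)),
    (a ((j + 1) * 2 ^ l) - a (j * 2 ^ l)) ^ 2 with he
  have he0 : ∀ l, 0 ≤ e l := fun l => Finset.sum_nonneg fun _ _ => sq_nonneg _
  have h1 := abs_sub_zero_le_sum_of_dyadic N a (fun l => √(e l)) (fun l _ j hj => by
    refine Real.abs_le_sqrt ?_
    exact Finset.single_le_sum (f := fun j => (a ((j + 1) * 2 ^ l) - a (j * 2 ^ l)) ^ 2)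
      (fun _ _ => sq_nonneg _) (Finset.mem_range.2 hj)) m hm
  calc (a m - a 0) ^ 2 = |a m - a 0| ^ 2 := (sq_abs _).symm
    _ ≤ (∑ l ∈ Finset.range (N + 1), √(e l)) ^ 2 := by gcongr
    _ ≤ (Finset.range (N + 1)).card * ∑ l ∈ Finset.range (N + 1), √(e l) ^ 2 :=
      sq_sum_le_card_mul_sum_sq
    _ = (N + 1) * dyadicEnergy N a := by
      simp only [Finset.card_range, Nat.cast_add, Nat.cast_one, Real.sq_sqrt (he0 _)]
      rfl

/-- A maximal inequality in the manner of Rademacher and Menshov: if the second moments of the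
increments grow at most linearly in time, then the maximum over `2 ^ N` steps costs only the
logarithmic factor `(N + 1) ^ 2`. -/
theorem measure_exists_le_abs_sub_zero_le {Ω : Type*} [MeasurableSpace Ω] {μ : Measure Ω}
    {Y : ℕ → Ω → ℝ} {σ : ℝ} (hint : ∀ i j, Integrable (fun ω => (Y j ω - Y i ω) ^ 2) μ)
    (hσ : ∀ i k, ∫ ω, (Y (i + k) ω - Y i ω) ^ 2 ∂μ ≤ k * σ) (N : ℕ) {η : ℝ} (hη : 0 < η) :
    μ {ω | ∃ m ≤ 2 ^ N, η ≤ |Y m ω - Y 0 ω|} ≤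
      ENNReal.ofReal ((N + 1) ^ 2 * 2 ^ N * σ / η ^ 2) := by
  have hE : Integrable (fun ω => dyadicEnergy N (fun m => Y m ω)) μ :=
    integrable_finsetSum _ fun l _ => integrable_finsetSum _ fun j _ => hint _ _
  have hEle : ∫ ω, dyadicEnergy N (fun m => Y m ω) ∂μ ≤ (N + 1) * 2 ^ N * σ := by
    unfold dyadicEnergy
    rw [integral_finsetSum _ fun l _ => integrable_finsetSum _ fun j _ => hint _ _]
    have : ∀ l ∈ Finset.range (N + 1), ∫ ω, ∑ j ∈ Finset.range (2 ^ (N - l)),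
        (Y ((j + 1) * 2 ^ l) ω - Y (j * 2 ^ l) ω) ^ 2 ∂μ ≤ 2 ^ N * σ := by
      intro l hl
      rw [integral_finsetSum _ fun j _ => hint _ _]
      calc _ ≤ ∑ j ∈ Finset.range (2 ^ (N - l)), ((2 ^ l : ℕ) : ℝ) * σ :=
            Finset.sum_le_sum fun j _ => by
              have := hσ (j * 2 ^ l) (2 ^ l)
              rwa [← Nat.succ_mul] at this
        _ = 2 ^ N * σ := by
          simp only [Finset.sum_const, Finset.card_range, nsmul_eq_mul, ← mul_assoc]
          rw [← Nat.cast_mul, ← pow_add, Nat.sub_add_cancel (by simp at hl; omega)]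
          norm_num
    refine (Finset.sum_le_sum this).trans_eq ?_
    simp only [Finset.sum_const, Finset.card_range, nsmul_eq_mul]
    push_cast; ring
  have hsub : {ω | ∃ m ≤ 2 ^ N, η ≤ |Y m ω - Y 0 ω|} ⊆
      {ω | ENNReal.ofReal (η ^ 2) ≤
        ENNReal.ofReal ((N + 1) * dyadicEnergy N (fun m => Y m ω))} := by
    rintro ω ⟨m, hm, h⟩
    refine ENNReal.ofReal_le_ofReal ?_
    refine le_trans ?_ (sq_sub_zero_le_dyadicEnergy (fun m => Y m ω) hm)
    rw [← sq_abs (Y m ω - Y 0 ω)]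
    gcongr
  have hnn : ∀ ω, 0 ≤ dyadicEnergy N (fun m => Y m ω) := fun ω =>
    Finset.sum_nonneg fun _ _ => Finset.sum_nonneg fun _ _ => sq_nonneg _
  calc _ ≤ _ := measure_mono hsub
    _ ≤ (∫⁻ ω, ENNReal.ofReal ((N + 1) * dyadicEnergy N (fun m => Y m ω)) ∂μ) /
          ENNReal.ofReal (η ^ 2) :=
      meas_ge_le_lintegral_div (hE.const_mul _).aemeasurable.ennreal_ofReal
        (by simpa using hη.ne') ENNReal.ofReal_ne_top
    _ = ENNReal.ofReal ((N + 1) * ∫ ω, dyadicEnergy N (fun m => Y m ω) ∂μ) /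
          ENNReal.ofReal (η ^ 2) := by
      rw [← ofReal_integral_eq_lintegral_ofReal (hE.const_mul _)
        (ae_of_all _ fun ω => mul_nonneg (by positivity) (hnn ω)), integral_const_mul]
    _ = ENNReal.ofReal ((N + 1) * (∫ ω, dyadicEnergy N (fun m => Y m ω) ∂μ) / η ^ 2) := by
      rw [ENNReal.ofReal_div_of_pos (by positivity)]
    _ ≤ _ := by
      refine ENNReal.ofReal_le_ofReal (div_le_div_of_nonneg_right ?_ (by positivity))
      refine (mul_le_mul_of_nonneg_left hEle (by positivity)).trans_eq ?_
      ring

/-! ### Stationary reversible random recursions -/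

/-- The sequence `X` starts from the law `π` and is driven by i.i.d. noise `V` of law `ν`,
independent of `X 0`, through the update map `Φ`; the one-step transition is reversible with
respect to `π`. -/
structure IsReversibleRecursion {E S Ω : Type*} [MeasurableSpace E] [MeasurableSpace S]
    [MeasurableSpace Ω] (Φ : E × S → E) (π : Measure E) (ν : Measure S) (μ : Measure Ω)
    (X : ℕ → Ω → E) (V : ℕ → Ω → S) : Prop where
  measurable_update : Measurable Φ
  law_init : HasLaw (X 0) π μ
  law_noise : ∀ m, HasLaw (V m) ν μ
  indep_init : IndepFun (X 0) (fun ω m => V m ω) μ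
  indep_noise : iIndepFun V μ
  step : ∀ m, ∀ᵐ ω ∂μ, X (m + 1) ω = Φ (X m ω, V m ω)
  reversible : (π.prod ν).map (fun z => (Φ z, z.1)) = (π.prod ν).map (fun z => (z.1, Φ z))

/-- If `X` is independent of the pair `(A, B)`, and `A` of `B`, then `(X, A)` is independent
of `B`. -/
theorem indepFun_prodMk_left {Ω α β γ : Type*} [MeasurableSpace Ω]
    [MeasurableSpace α] [MeasurableSpace β] [MeasurableSpace γ] {μ : Measure Ω}
    [IsProbabilityMeasure μ] {X : Ω → α} {A : Ω → β} {B : Ω → γ} (hX : AEMeasurable X μ)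
    (hA : AEMeasurable A μ) (hB : AEMeasurable B μ)
    (h : IndepFun X (fun ω => (A ω, B ω)) μ) (hAB : IndepFun A B μ) :
    IndepFun (fun ω => (X ω, A ω)) B μ := by
  have hXA : IndepFun X A μ := h.comp measurable_id measurable_fst
  rw [indepFun_iff_map_prod_eq_prod_map_map (hX.prodMk hA) hB,
    hXA.map_prod_eq_prod_map_map hX hA]
  have e : (fun ω => ((X ω, A ω), B ω)) =
      (MeasurableEquiv.prodAssoc (α := α) (β := β) (γ := γ)).symm ∘
        (fun ω => (X ω, (A ω, B ω))) := rfl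
  rw [e, ← AEMeasurable.map_map_of_aemeasurable
    (MeasurableEquiv.measurable _).aemeasurable (hX.prodMk (hA.prodMk hB)),
    h.map_prod_eq_prod_map_map hX (hA.prodMk hB), hAB.map_prod_eq_prod_map_map hA hB]
  have := Measure.isProbabilityMeasure_map hX
  have := Measure.isProbabilityMeasure_map hA
  have := Measure.isProbabilityMeasure_map hB
  rw [MeasurableEquiv.map_apply_eq_iff_map_symm_apply_eq, MeasurableEquiv.symm_symm]
  exact (measurePreserving_prodAssoc _ _ _).map_eq.symm

namespace IsReversibleRecursion

variable {E S Ω : Type*} [MeasurableSpace E] [MeasurableSpace S] [MeasurableSpace Ω]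
  {Φ : E × S → E} {π : Measure E} {ν : Measure S} {μ : Measure Ω} [IsProbabilityMeasure μ]
  {X : ℕ → Ω → E} {V : ℕ → Ω → S}

omit [IsProbabilityMeasure μ] in
theorem exists_eq_past (h : IsReversibleRecursion Φ π ν μ X V) {i n : ℕ} (hi : i ≤ n) :
    ∃ G : E × (Finset.range n → S) → E, Measurable G ∧
      ∀ᵐ ω ∂μ, X i ω = G (X 0 ω, fun j => V j ω) := by
  induction i with
  | zero => exact ⟨Prod.fst, measurable_fst, ae_of_all _ fun _ => rfl⟩
  | succ i ih =>
    obtain ⟨G, hG, hGe⟩ := ih (by omega)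
    refine ⟨fun z => Φ (G z, z.2 ⟨i, Finset.mem_range.2 hi⟩),
      h.measurable_update.comp (hG.prodMk ((measurable_pi_apply _).comp measurable_snd)), ?_⟩
    filter_upwards [hGe, h.step i] with ω h1 h2
    rw [h2, h1]

theorem indepFun_pair_noise (h : IsReversibleRecursion Φ π ν μ X V) (i k : ℕ) :
    IndepFun (fun ω => (X i ω, X (i + k) ω)) (V (i + k)) μ := by
  obtain ⟨G, hG, hGe⟩ := h.exists_eq_past (Nat.le_add_right i k)
  obtain ⟨G', hG', hGe'⟩ := h.exists_eq_past (le_refl (i + k))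
  have hVm : ∀ m, AEMeasurable (V m) μ := fun m => (h.law_noise m).aemeasurable
  have h1 : IndepFun (fun ω (j : Finset.range (i + k)) => V j ω) (V (i + k)) μ :=
    (h.indep_noise.indepFun_finset₀ (Finset.range (i + k)) {i + k} (by simp) hVm).comp
      (φ := id) (ψ := fun v : ({i + k} : Finset ℕ) → S => v ⟨i + k, by simp⟩) measurable_id
      (measurable_pi_apply _)
  have h2 : IndepFun (X 0) (fun ω => ((fun j : Finset.range (i + k) => V j ω), V (i + k) ω)) μ :=
    h.indep_init.comp (φ := id)
      (ψ := fun v : ℕ → S => ((fun j : Finset.range (i + k) => v j), v (i + k)))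
      measurable_id (by fun_prop)
  have h3 := indepFun_prodMk_left h.law_init.aemeasurable
    (aemeasurable_pi_lambda _ fun j => hVm _) (hVm _) h2 h1
  refine (h3.comp (φ := fun z => (G z, G' z)) (ψ := id) (hG.prodMk hG') measurable_id).congr
    ?_ (ae_eq_refl _)
  filter_upwards [hGe, hGe'] with ω h1 h2
  exact Prod.ext h1.symm h2.symm

variable [IsProbabilityMeasure ν]

omit [IsProbabilityMeasure μ] in
theorem map_update (h : IsReversibleRecursion Φ π ν μ X V) : (π.prod ν).map Φ = π := by
  have h1 : (π.prod ν).map Φ = ((π.prod ν).map (fun z => (Φ z, z.1))).map Prod.fst := by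
    rw [Measure.map_map measurable_fst (h.measurable_update.prodMk measurable_fst)]; rfl
  rw [h1, h.reversible, Measure.map_map measurable_fst
    (measurable_fst.prodMk h.measurable_update)]
  exact measurePreserving_fst.map_eq

theorem hasLaw (h : IsReversibleRecursion Φ π ν μ X V) (m : ℕ) : HasLaw (X m) π μ := by
  induction m with
  | zero => exact h.law_init
  | succ m ih =>
    have hind : IndepFun (X m) (V m) μ :=
      (h.indepFun_pair_noise m 0).comp (φ := Prod.fst) (ψ := id) measurable_fst measurable_id
    have := hind.hasLaw_prod ih (h.law_noise m)
    have h2 : HasLaw Φ π (π.prod ν) := ⟨h.measurable_update.aemeasurable, h.map_update⟩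
    exact (h2.comp this).congr (h.step m)

theorem hasLaw_noise (h : IsReversibleRecursion Φ π ν μ X V) (m : ℕ) :
    HasLaw (fun ω => (X m ω, V m ω)) (π.prod ν) μ :=
  ((h.indepFun_pair_noise m 0).comp (φ := Prod.fst) (ψ := id) measurable_fst
    measurable_id).hasLaw_prod (h.hasLaw m) (h.law_noise m)

end IsReversibleRecursion

section TransitionOperator

variable {E S : Type*} [MeasurableSpace E] [MeasurableSpace S]

/-- Bounded measurable real functions, the domain on which the transition operator acts. -/
def IsBoundedMeasurable (f : E → ℝ) : Prop :=
  Measurable f ∧ ∃ C, ∀ x, |f x| ≤ C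

namespace IsBoundedMeasurable

variable {f g : E → ℝ}

theorem sub (hf : IsBoundedMeasurable f) (hg : IsBoundedMeasurable g) :
    IsBoundedMeasurable (f - g) := by
  obtain ⟨hf, C, hC⟩ := hf
  obtain ⟨hg, D, hD⟩ := hg
  exact ⟨hf.sub hg, C + D, fun x => (abs_sub _ _).trans (add_le_add (hC x) (hD x))⟩

theorem mul (hf : IsBoundedMeasurable f) (hg : IsBoundedMeasurable g) :
    IsBoundedMeasurable (f * g) := by
  obtain ⟨hf, C, hC⟩ := hf
  obtain ⟨hg, D, hD⟩ := hg
  refine ⟨hf.mul hg, C * D, fun x => ?_⟩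
  rw [Pi.mul_apply, abs_mul]
  exact mul_le_mul (hC x) (hD x) (abs_nonneg _) ((abs_nonneg _).trans (hC x))

theorem comp {F : Type*} [MeasurableSpace F] {φ : F → E} (hf : IsBoundedMeasurable f)
    (hφ : Measurable φ) : IsBoundedMeasurable (fun y => f (φ y)) :=
  ⟨hf.1.comp hφ, hf.2.imp fun _ h y => h (φ y)⟩

theorem integrable {ρ : Measure E} [IsFiniteMeasure ρ] (hf : IsBoundedMeasurable f) :
    Integrable f ρ := by
  obtain ⟨hf, C, hC⟩ := hf
  exact Integrable.of_bound hf.aestronglyMeasurable C (ae_of_all _ hC)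

end IsBoundedMeasurable

/-- The transition operator of the recursion with update map `Φ` and noise law `ν`. -/
noncomputable def transitionOp (Φ : E × S → E) (ν : Measure S) (f : E → ℝ) (x : E) : ℝ :=
  ∫ v, f (Φ (x, v)) ∂ν

variable {Φ : E × S → E} {π : Measure E} {ν : Measure S} [IsProbabilityMeasure ν]

theorem IsBoundedMeasurable.transitionOp {f : E → ℝ} (hf : IsBoundedMeasurable f)
    (hΦ : Measurable Φ) : IsBoundedMeasurable (transitionOp Φ ν f) := by
  refine ⟨((hf.1.comp hΦ).stronglyMeasurable.integral_prod_right').measurable, ?_⟩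
  obtain ⟨C, hC⟩ := hf.2
  refine ⟨C, fun x => ?_⟩
  have := norm_integral_le_of_norm_le_const (μ := ν) (f := fun v => f (Φ (x, v)))
    (ae_of_all _ fun v => hC (Φ (x, v)))
  simpa [_root_.transitionOp] using this

theorem IsBoundedMeasurable.iterate_transitionOp {f : E → ℝ} (hf : IsBoundedMeasurable f)
    (hΦ : Measurable Φ) (k : ℕ) : IsBoundedMeasurable ((_root_.transitionOp Φ ν)^[k] f) := by
  induction k with
  | zero => exact hf
  | succ k ih => rw [Function.iterate_succ_apply']; exact ih.transitionOp hΦ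

theorem transitionOp_sub (hΦ : Measurable Φ) {f g : E → ℝ} (hf : IsBoundedMeasurable f)
    (hg : IsBoundedMeasurable g) :
    transitionOp Φ ν (f - g) = transitionOp Φ ν f - transitionOp Φ ν g := by
  funext x
  have hm : Measurable fun v => Φ (x, v) := hΦ.comp measurable_prodMk_left
  exact integral_sub (hf.comp hm).integrable (hg.comp hm).integrable

variable [IsProbabilityMeasure π]

theorem integral_mul_update (hΦ : Measurable Φ) {F f : E → ℝ} (hF : IsBoundedMeasurable F)
    (hf : IsBoundedMeasurable f) :
    ∫ z, F z.1 * f (Φ z) ∂(π.prod ν) = ∫ x, (F * transitionOp Φ ν f) x ∂π := by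
  have hi : Integrable (fun z : E × S => F z.1 * f (Φ z)) (π.prod ν) :=
    ((hF.comp measurable_fst).mul (hf.comp hΦ)).integrable
  rw [integral_prod _ hi]
  simp_rw [integral_const_mul]
  rfl

theorem integral_mul_transitionOp_comm (hΦ : Measurable Φ)
    (hrev : (π.prod ν).map (fun z => (Φ z, z.1)) = (π.prod ν).map (fun z => (z.1, Φ z)))
    {F f : E → ℝ} (hF : IsBoundedMeasurable F) (hf : IsBoundedMeasurable f) :
    ∫ x, (F * transitionOp Φ ν f) x ∂π = ∫ x, (transitionOp Φ ν F * f) x ∂π := by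
  have hm : Measurable fun p : E × E => F p.1 * f p.2 := by
    have := hF.1; have := hf.1; fun_prop
  have h1 := integral_map (μ := π.prod ν) (measurable_fst.prodMk hΦ).aemeasurable
    hm.aestronglyMeasurable
  have h2 := integral_map (μ := π.prod ν) (hΦ.prodMk measurable_fst).aemeasurable
    hm.aestronglyMeasurable
  rw [hrev] at h2
  rw [← integral_mul_update hΦ hF hf, mul_comm (transitionOp Φ ν F), ← integral_mul_update hΦ hf hF]
  refine h1.symm.trans (h2.trans ?_)
  exact integral_congr_ae (ae_of_all _ fun z => mul_comm _ _)

/-- For `c = 1` and `c = -1`: the operators `1 + P` and `1 - P` are positive, the quadratic form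
being half the mean square of `g (X 0) + c * g (X 1)`. -/
theorem integral_mul_self_add_nonneg (hΦ : Measurable Φ)
    (hrev : (π.prod ν).map (fun z => (Φ z, z.1)) = (π.prod ν).map (fun z => (z.1, Φ z)))
    {g : E → ℝ} (hg : IsBoundedMeasurable g) {c : ℝ} (hc : c ^ 2 = 1) :
    0 ≤ ∫ x, (g * g) x ∂π + c * ∫ x, (g * transitionOp Φ ν g) x ∂π := by
  have hm : Measurable fun p : E × E => g p.2 * g p.2 := by
    have := hg.1; fun_prop
  have h2 : ∫ z, g (Φ z) * g (Φ z) ∂(π.prod ν) = ∫ z, g z.1 * g z.1 ∂(π.prod ν) := by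
    have h1 := integral_map (μ := π.prod ν) (measurable_fst.prodMk hΦ).aemeasurable
      hm.aestronglyMeasurable
    have h2 := integral_map (μ := π.prod ν) (hΦ.prodMk measurable_fst).aemeasurable
      hm.aestronglyMeasurable
    rw [hrev] at h2
    exact h1.symm.trans h2
  have h3 : ∫ z, g z.1 * g z.1 ∂(π.prod ν) = ∫ x, (g * g) x ∂π := by
    rw [integral_fun_fst (μ := π) (ν := ν) (f := fun x => g x * g x)]
    simp
  have i1 : Integrable (fun z : E × S => g z.1 * g z.1) (π.prod ν) :=
    ((hg.comp measurable_fst).mul (hg.comp measurable_fst)).integrable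
  have i2 : Integrable (fun z : E × S => g z.1 * g (Φ z)) (π.prod ν) :=
    ((hg.comp measurable_fst).mul (hg.comp hΦ)).integrable
  have i3 : Integrable (fun z : E × S => g (Φ z) * g (Φ z)) (π.prod ν) :=
    ((hg.comp hΦ).mul (hg.comp hΦ)).integrable
  have h4 : ∫ z, (g z.1 + c * g (Φ z)) ^ 2 ∂(π.prod ν) =
      ∫ z, (g z.1 * g z.1 + 2 * c * (g z.1 * g (Φ z)) + g (Φ z) * g (Φ z)) ∂(π.prod ν) := by
    refine integral_congr_ae (ae_of_all _ fun z => ?_)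
    linear_combination (g (Φ z)) ^ 2 * hc
  have h5 : 0 ≤ ∫ z, (g z.1 + c * g (Φ z)) ^ 2 ∂(π.prod ν) :=
    integral_nonneg fun _ => sq_nonneg _
  have i12 : Integrable (fun z : E × S => g z.1 * g z.1 + 2 * c * (g z.1 * g (Φ z)))
      (π.prod ν) := i1.add (i2.const_mul _)
  rw [h4, integral_add i12 i3, integral_add i1 (i2.const_mul _),
    integral_const_mul, h2, h3, integral_mul_update hΦ hg hg] at h5
  linarith

variable (Φ π ν) in
/-- The stationary autocovariance sequence `k ↦ ⟨f, P ^ k f⟩` of the observable `f` (without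
centring). -/
noncomputable def autocorrelation (f : E → ℝ) (k : ℕ) : ℝ :=
  ∫ x, (f * (transitionOp Φ ν)^[k] f) x ∂π

theorem integral_iterate_mul_iterate (hΦ : Measurable Φ)
    (hrev : (π.prod ν).map (fun z => (Φ z, z.1)) = (π.prod ν).map (fun z => (z.1, Φ z)))
    {f : E → ℝ} (hf : IsBoundedMeasurable f) (i j : ℕ) :
    ∫ x, ((transitionOp Φ ν)^[i] f * (transitionOp Φ ν)^[j] f) x ∂π =
      autocorrelation Φ π ν f (i + j) := by
  induction i generalizing j with
  | zero => rw [zero_add]; rfl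
  | succ i ih =>
    rw [Function.iterate_succ_apply', ← integral_mul_transitionOp_comm hΦ hrev
      (hf.iterate_transitionOp hΦ i) (hf.iterate_transitionOp hΦ j),
      ← Function.iterate_succ_apply' (transitionOp Φ ν), ih, add_right_comm, add_assoc]

theorem autocorrelation_form_nonneg (hΦ : Measurable Φ)
    (hrev : (π.prod ν).map (fun z => (Φ z, z.1)) = (π.prod ν).map (fun z => (z.1, Φ z)))
    {f : E → ℝ} (hf : IsBoundedMeasurable f) {c : ℝ} (hc : c ^ 2 = 1) (i j : ℕ) :
    let a := autocorrelation Φ π ν f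
    0 ≤ (a (i + i) - 2 * a (i + j) + a (j + j)) +
      c * (a (i + i + 1) - 2 * a (i + j + 1) + a (j + j + 1)) := by
  intro a
  have hP : ∀ k, IsBoundedMeasurable ((transitionOp Φ ν)^[k] f) := hf.iterate_transitionOp hΦ
  have I : ∀ k l, Integrable ((transitionOp Φ ν)^[k] f * (transitionOp Φ ν)^[l] f) π :=
    fun k l => ((hP k).mul (hP l)).integrable
  have A : ∀ k l, ∫ x, ((transitionOp Φ ν)^[k] f * (transitionOp Φ ν)^[l] f) x ∂π = a (k + l) :=
    integral_iterate_mul_iterate hΦ hrev hf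
  have expand : ∀ k l m n,
      ∫ x, (((transitionOp Φ ν)^[k] f - (transitionOp Φ ν)^[l] f) *
        ((transitionOp Φ ν)^[m] f - (transitionOp Φ ν)^[n] f)) x ∂π =
      a (k + m) - a (k + n) - (a (l + m) - a (l + n)) := by
    intro k l m n
    rw [sub_mul, mul_sub, mul_sub, ← A, ← A, ← A, ← A]
    rw [integral_sub' ((I _ _).sub (I _ _)) ((I _ _).sub (I _ _)), integral_sub' (I _ _) (I _ _),
      integral_sub' (I _ _) (I _ _)]
  have key := integral_mul_self_add_nonneg hΦ hrev ((hP i).sub (hP j)) hc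
  rw [transitionOp_sub hΦ (hP i) (hP j), ← Function.iterate_succ_apply' (transitionOp Φ ν),
    ← Function.iterate_succ_apply' (transitionOp Φ ν), expand, expand] at key
  have e1 : j + i = i + j := add_comm _ _
  have e2 : i + (i + 1) = i + i + 1 := by ring
  have e3 : i + (j + 1) = i + j + 1 := by ring
  have e4 : j + (i + 1) = i + j + 1 := by ring
  have e5 : j + (j + 1) = j + j + 1 := by ring
  simp only [Nat.succ_eq_add_one, e1, e2, e3, e4, e5] at key
  linarith

/-- Over `k` steps the Dirichlet form grows at most linearly. With `b j = a j - a (j + 1)` for the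
autocorrelations `a`, positivity of `1 - P` at `f - P ^ j f` gives `2 b j ≤ b 0 + b (2 j)`, and
positivity of `1 + P` at `P ^ j f - P ^ (j + 1) f` gives `b (2 j + 2) ≤ b (2 j)`. -/
theorem autocorrelation_zero_sub_le (hΦ : Measurable Φ)
    (hrev : (π.prod ν).map (fun z => (Φ z, z.1)) = (π.prod ν).map (fun z => (z.1, Φ z)))
    {f : E → ℝ} (hf : IsBoundedMeasurable f) (k : ℕ) :
    autocorrelation Φ π ν f 0 - autocorrelation Φ π ν f k ≤
      k * (autocorrelation Φ π ν f 0 - autocorrelation Φ π ν f 1) := by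
  set a := autocorrelation Φ π ν f with ha
  have even : ∀ i, a (i + i) - a (i + i + 1) ≤ a 0 - a 1 := by
    intro i
    induction i with
    | zero => simp
    | succ i ih =>
      have := autocorrelation_form_nonneg hΦ hrev hf (c := 1) (by norm_num) i (i + 1)
      simp only [← ha] at this
      have e1 : i + (i + 1) = i + i + 1 := by ring
      have e2 : i + 1 + (i + 1) = i + i + 2 := by ring
      rw [e1, e2] at this
      rw [e2]
      linarith
  have all : ∀ j, a j - a (j + 1) ≤ a 0 - a 1 := by
    intro j
    have := autocorrelation_form_nonneg hΦ hrev hf (c := -1) (by norm_num) 0 j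
    simp only [← ha, zero_add] at this
    linarith [even j]
  induction k with
  | zero => simp
  | succ k ih => push_cast; linarith [all k]

end TransitionOperator

namespace IsReversibleRecursion

variable {E S Ω : Type*} [MeasurableSpace E] [MeasurableSpace S] [MeasurableSpace Ω]
  {Φ : E × S → E} {π : Measure E} {ν : Measure S} {μ : Measure Ω} [IsProbabilityMeasure μ]
  {X : ℕ → Ω → E} {V : ℕ → Ω → S} [IsProbabilityMeasure ν]

/-- The Markov property at two times. -/
theorem integral_mul_eq (h : IsReversibleRecursion Φ π ν μ X V) {F : E → ℝ}
    (hF : IsBoundedMeasurable F) (i k : ℕ) : ∀ {f : E → ℝ}, IsBoundedMeasurable f →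
    ∫ ω, F (X i ω) * f (X (i + k) ω) ∂μ = ∫ x, (F * (transitionOp Φ ν)^[k] f) x ∂π := by
  induction k with
  | zero =>
    intro f hf
    have := integral_map (h.hasLaw i).aemeasurable (hF.mul hf).1.aestronglyMeasurable
    rw [(h.hasLaw i).map_eq] at this
    exact this.symm
  | succ k ih =>
    intro f hf
    rw [Function.iterate_succ_apply, ← ih (hf.transitionOp h.measurable_update)]
    have hpair : AEMeasurable (fun ω => (X i ω, X (i + k) ω)) μ :=
      (h.hasLaw i).aemeasurable.prodMk (h.hasLaw (i + k)).aemeasurable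
    have := Measure.isProbabilityMeasure_map hpair
    have hlaw := (h.indepFun_pair_noise i k).hasLaw_prod ⟨hpair, rfl⟩ (h.law_noise (i + k))
    have hG : IsBoundedMeasurable (fun z : (E × E) × S => F z.1.1 * f (Φ (z.1.2, z.2))) :=
      (hF.comp (measurable_fst.comp measurable_fst)).mul
        (hf.comp (h.measurable_update.comp
          ((measurable_snd.comp measurable_fst).prodMk measurable_snd)))
    calc ∫ ω, F (X i ω) * f (X (i + (k + 1)) ω) ∂μ
        = ∫ ω, F (X i ω) * f (Φ (X (i + k) ω, V (i + k) ω)) ∂μ := by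
          refine integral_congr_ae ?_
          filter_upwards [h.step (i + k)] with ω hω
          rw [← add_assoc, hω]
      _ = ∫ z, F z.1.1 * f (Φ (z.1.2, z.2))
            ∂((μ.map (fun ω => (X i ω, X (i + k) ω))).prod ν) := by
          rw [← hlaw.map_eq, integral_map hlaw.aemeasurable hG.1.aestronglyMeasurable]
      _ = ∫ p, F p.1 * transitionOp Φ ν f p.2 ∂(μ.map (fun ω => (X i ω, X (i + k) ω))) := by
          rw [integral_prod _ hG.integrable]
          simp_rw [integral_const_mul]
          rfl
      _ = _ := by
          rw [integral_map hpair]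
          exact ((hF.comp measurable_fst).mul ((hf.transitionOp h.measurable_update).comp
            measurable_snd)).1.aestronglyMeasurable

theorem integrable_sq_sub (h : IsReversibleRecursion Φ π ν μ X V) {f : E → ℝ}
    (hf : IsBoundedMeasurable f) (i j : ℕ) :
    Integrable (fun ω => (f (X j ω) - f (X i ω)) ^ 2) μ := by
  have hd : IsBoundedMeasurable (fun p : E × E => f p.2 - f p.1) :=
    (hf.comp measurable_snd).sub (hf.comp measurable_fst)
  simp_rw [pow_two]
  exact (Integrable.comp_aemeasurable (f := fun ω => (X i ω, X j ω)) (hd.mul hd).integrable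
    ((h.hasLaw i).aemeasurable.prodMk (h.hasLaw j).aemeasurable))

theorem integral_sq_sub_eq (h : IsReversibleRecursion Φ π ν μ X V) {f : E → ℝ}
    (hf : IsBoundedMeasurable f) (i k : ℕ) :
    ∫ ω, (f (X (i + k) ω) - f (X i ω)) ^ 2 ∂μ =
      2 * (autocorrelation Φ π ν f 0 - autocorrelation Φ π ν f k) := by
  have I : ∀ k l, Integrable (fun ω => f (X k ω) * f (X l ω)) μ := fun k l =>
    Integrable.comp_aemeasurable (f := fun ω => (X k ω, X l ω))
      ((hf.comp measurable_fst).mul (hf.comp measurable_snd)).integrable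
      ((h.hasLaw k).aemeasurable.prodMk (h.hasLaw l).aemeasurable)
  have e : ∀ ω, (f (X (i + k) ω) - f (X i ω)) ^ 2 = f (X (i + k) ω) * f (X (i + k) ω) -
      2 * (f (X i ω) * f (X (i + k) ω)) + f (X i ω) * f (X i ω) := fun ω => by ring
  simp_rw [e]
  have I' : Integrable (fun ω => f (X (i + k) ω) * f (X (i + k) ω) -
      2 * (f (X i ω) * f (X (i + k) ω))) μ := (I _ _).sub ((I _ _).const_mul _)
  rw [integral_add I' (I _ _), integral_sub (I _ _) ((I _ _).const_mul _), integral_const_mul]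
  have h0 := h.integral_mul_eq hf i 0 hf
  have h1 := h.integral_mul_eq hf (i + k) 0 hf
  have h2 := h.integral_mul_eq hf i k hf
  simp only [add_zero] at h0 h1
  rw [h0, h1, h2]
  unfold autocorrelation
  ring

variable [IsProbabilityMeasure π]

/-- For a stationary reversible chain the mean square displacement of an observable over `k` steps
is at most `k` times that over one step. -/
theorem integral_sq_sub_le (h : IsReversibleRecursion Φ π ν μ X V) {f : E → ℝ}
    (hf : IsBoundedMeasurable f) (i k : ℕ) :
    ∫ ω, (f (X (i + k) ω) - f (X i ω)) ^ 2 ∂μ ≤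
      k * ∫ z, (f (Φ z) - f z.1) ^ 2 ∂(π.prod ν) := by
  have h1 : ∫ ω, (f (X (0 + 1) ω) - f (X 0 ω)) ^ 2 ∂μ =
      ∫ z, (f (Φ z) - f z.1) ^ 2 ∂(π.prod ν) := by
    rw [← (h.hasLaw_noise 0).map_eq, integral_map (h.hasLaw_noise 0).aemeasurable]
    · refine integral_congr_ae ?_
      filter_upwards [h.step 0] with ω hω
      rw [hω]
    · exact (((hf.1.comp h.measurable_update).sub (hf.1.comp measurable_fst)).pow_const
        2).aestronglyMeasurable
  rw [← h1, h.integral_sq_sub_eq hf, h.integral_sq_sub_eq hf]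
  linarith [autocorrelation_zero_sub_le (π := π) (ν := ν) h.measurable_update h.reversible hf k]

end IsReversibleRecursion

/-! ### The Gaussian scale mixture and its density -/

theorem pi_withDensity_ofReal {d : ℕ} {f : ℝ → ℝ} (hi : Integrable f)
    (h0 : ∀ x, 0 ≤ f x) :
    Measure.pi (fun _ : Fin d => (volume : Measure ℝ).withDensity fun x => ENNReal.ofReal (f x)) =
      (volume : Measure (Fin d → ℝ)).withDensity (fun x => ∏ i, ENNReal.ofReal (f (x i))) := by
  have : IsFiniteMeasure ((volume : Measure ℝ).withDensity fun x => ENNReal.ofReal (f x)) :=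
    isFiniteMeasure_withDensity_ofReal hi.2
  refine Measure.pi_eq fun s hs => ?_
  rw [withDensity_apply _ (MeasurableSet.univ_pi hs), volume_pi, Measure.restrict_pi_pi]
  have hi' : ∀ i, Integrable f (volume.restrict (s i)) := fun i => hi.restrict
  simp_rw [← ENNReal.ofReal_prod_of_nonneg fun i _ => h0 _]
  rw [← ofReal_integral_eq_lintegral_ofReal (Integrable.fintype_prod hi')
    (ae_of_all _ fun x => Finset.prod_nonneg fun i _ => h0 _),
    integral_fintype_prod_eq_prod (f := fun _ => f),
    ENNReal.ofReal_prod_of_nonneg fun i _ => integral_nonneg fun _ => h0 _]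
  refine Finset.prod_congr rfl fun i _ => ?_
  rw [withDensity_apply _ (hs i), ofReal_integral_eq_lintegral_ofReal (hi' i)
    (ae_of_all _ fun x => h0 _)]

theorem map_sqrt_smul_stdGaussian (d : ℕ) {y : ℝ} (hy : 0 < y) :
    (stdGaussian (EuclideanSpace ℝ (Fin d))).map (fun x => √y • x) =
      volume.withDensity (fun x => ∏ i, gaussianPDF 0 y.toNNReal (x i)) := by
  have hy' : y.toNNReal ≠ 0 := by simpa using hy
  have h1 : (Measure.pi (fun _ : Fin d => gaussianReal 0 1)).map (fun x i => √y * x i) =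
      (volume : Measure (Fin d → ℝ)).withDensity
        (fun x => ∏ i, gaussianPDF 0 y.toNNReal (x i)) := by
    rw [Measure.pi_map_pi fun i => (measurable_const_mul _).aemeasurable]
    have : (gaussianReal 0 1).map (fun x => √y * x) = gaussianReal 0 y.toNNReal := by
      rw [gaussianReal_map_const_mul, mul_zero]
      congr 1
      ext
      simp [Real.sq_sqrt hy.le, hy.le]
    simp_rw [this, gaussianReal_of_var_ne_zero _ hy']
    exact pi_withDensity_ofReal (integrable_gaussianPDFReal _ _)
      (gaussianPDFReal_nonneg _ _)
  have hT : Measurable (WithLp.toLp 2 : (Fin d → ℝ) → EuclideanSpace ℝ (Fin d)) := by fun_prop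
  rw [← map_pi_eq_stdGaussian, Measure.map_map (by fun_prop) hT]
  have e : (fun x : EuclideanSpace ℝ (Fin d) => √y • x) ∘ WithLp.toLp 2 =
      WithLp.toLp 2 ∘ (fun (x : Fin d → ℝ) i => √y * x i) := rfl
  rw [e, ← Measure.map_map hT (by fun_prop), h1]
  ext A hA
  rw [Measure.map_apply hT hA, withDensity_apply _ (hT hA), withDensity_apply _ hA,
    ← (PiLp.volume_preserving_toLp (Fin d)).setLIntegral_comp_preimage hA]
  have := measurable_gaussianPDF 0 y.toNNReal
  fun_prop

theorem measurable_gaussianPDF_toNNReal :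
    Measurable fun z : ℝ × ℝ => gaussianPDF 0 z.1.toNNReal z.2 := by
  unfold gaussianPDF gaussianPDFReal
  fun_prop

theorem measurable_prod_gaussianPDF (d : ℕ) :
    Measurable fun z : EuclideanSpace ℝ (Fin d) × ℝ =>
      ∏ i, gaussianPDF 0 z.2.toNNReal (z.1 i) := by
  refine Finset.measurable_prod _ fun i _ => ?_
  exact measurable_gaussianPDF_toNNReal.comp
    (f := fun z : EuclideanSpace ℝ (Fin d) × ℝ => (z.2, z.1 i)) (by fun_prop)

section Target

variable (Q : Measure ℝ) [IsProbabilityMeasure Q] (d : ℕ)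

theorem measurable_targetDensity : Measurable (targetDensity Q d) :=
  (measurable_prod_gaussianPDF d).lintegral_prod_right'

theorem measurable_sqrt_smul :
    Measurable fun z : ℝ × EuclideanSpace ℝ (Fin d) => √z.1 • z.2 := by fun_prop

instance : IsProbabilityMeasure (targetLaw Q d) :=
  Measure.isProbabilityMeasure_map (measurable_sqrt_smul d).aemeasurable

variable {Q} in
theorem IsAdmissibleMixing.ae_pos (hQ : IsAdmissibleMixing Q) : ∀ᵐ y ∂Q, 0 < y := by
  rcases hQ with rfl | ⟨q, hq⟩
  · exact (ae_dirac_iff (p := fun y : ℝ => 0 < y) measurableSet_Ioi).2 one_pos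
  · rw [hq.eq_withDensity]
    have h : ∀ᵐ y ∂(volume.restrict (Ioi (0 : ℝ))), 0 < y := ae_restrict_mem measurableSet_Ioi
    exact (withDensity_absolutelyContinuous _ _).ae_le h

variable {Q} (hQ : ∀ᵐ y ∂Q, 0 < y)
include hQ

theorem targetLaw_eq_withDensity :
    targetLaw Q d = volume.withDensity (targetDensity Q d) := by
  ext A hA
  have hm := measurable_sqrt_smul d
  rw [targetLaw, Measure.map_apply hm hA, Measure.prod_apply (hm hA), withDensity_apply _ hA]
  unfold targetDensity
  rw [lintegral_lintegral_swap (measurable_prod_gaussianPDF d).aemeasurable]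
  refine lintegral_congr_ae ?_
  filter_upwards [hQ] with y hy
  rw [← withDensity_apply _ hA, ← map_sqrt_smul_stdGaussian d hy,
    Measure.map_apply (by fun_prop) hA]
  rfl

theorem targetDensity_pos (x : EuclideanSpace ℝ (Fin d)) : 0 < targetDensity Q d x := by
  have hm : Measurable fun y : ℝ => ∏ i, gaussianPDF 0 y.toNNReal (x i) :=
    Finset.measurable_prod _ fun i _ =>
      measurable_gaussianPDF_toNNReal.comp (measurable_id.prodMk measurable_const)
  rw [pos_iff_ne_zero, targetDensity, Ne, lintegral_eq_zero_iff hm]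
  intro h
  have : ∀ᵐ y ∂Q, False := by
    filter_upwards [hQ, h] with y hy h0
    refine (Finset.prod_ne_zero_iff.2 fun i _ => ?_) h0
    exact (gaussianPDF_pos _ (by simpa using hy) _).ne'
  exact NeZero.ne Q (by simpa using this)

theorem ae_targetDensity_lt_top : ∀ᵐ x, targetDensity Q d x < ∞ := by
  refine ae_lt_top (measurable_targetDensity Q d) ?_
  have h := targetLaw_eq_withDensity d hQ
  have h1 : targetLaw Q d univ = 1 := measure_univ
  rw [h, withDensity_apply _ MeasurableSet.univ, setLIntegral_univ] at h1
  rw [h1]; exact ENNReal.one_ne_top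

end Target

/-! ### Rotation invariance and directional moments -/

theorem targetLaw_map_linearIsometryEquiv (Q : Measure ℝ) [IsProbabilityMeasure Q] {d : ℕ}
    (A : EuclideanSpace ℝ (Fin d) ≃ₗᵢ[ℝ] EuclideanSpace ℝ (Fin d)) :
    (targetLaw Q d).map A = targetLaw Q d := by
  have hm := measurable_sqrt_smul d
  have hA : Measurable A := A.continuous.measurable
  have e : A ∘ (fun z : ℝ × EuclideanSpace ℝ (Fin d) => √z.1 • z.2) =
      (fun z => √z.1 • z.2) ∘ Prod.map id A := by
    funext z; simp
  unfold targetLaw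
  rw [Measure.map_map hA hm, e, ← Measure.map_map hm (measurable_id.prodMap hA),
    ← Measure.map_prod_map _ _ measurable_id hA, Measure.map_id, stdGaussian_map]

theorem map_inner_stdGaussian {d : ℕ} (x : EuclideanSpace ℝ (Fin d)) :
    (stdGaussian (EuclideanSpace ℝ (Fin d))).map (fun v => inner ℝ x v) =
      (gaussianReal 0 1).map (fun t => ‖x‖ * t) := by
  have h := IsGaussian.map_eq_gaussianReal (μ := stdGaussian (EuclideanSpace ℝ (Fin d)))
    (innerSL ℝ x)
  rw [integral_strongDual_stdGaussian, variance_dual_stdGaussian, innerSL_apply_norm] at h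
  rw [gaussianReal_map_const_mul, mul_zero]
  refine h.trans ?_
  congr 1
  ext
  simp

/-- The fourth moment of the standard normal law. -/
noncomputable def gaussianFourthMoment : ℝ≥0∞ :=
  ∫⁻ t, ENNReal.ofReal (t ^ 4) ∂(gaussianReal 0 1)

theorem gaussianFourthMoment_lt_top : gaussianFourthMoment < ∞ := by
  have h : Integrable (fun t : ℝ => t ^ 4) (gaussianReal 0 1) := by
    have := (memLp_id_gaussianReal (μ := 0) (v := 1) 4).integrable_norm_pow (by norm_num)
    refine this.congr (ae_of_all _ fun t => ?_)
    simp [Even.pow_abs (by decide : Even 4)]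
  rw [gaussianFourthMoment, ← ofReal_integral_eq_lintegral_ofReal h
    (ae_of_all _ fun t => by positivity)]
  exact ENNReal.ofReal_lt_top

theorem lintegral_inner_pow_four_stdGaussian {d : ℕ} (x : EuclideanSpace ℝ (Fin d)) :
    ∫⁻ v, ENNReal.ofReal (inner ℝ x v ^ 4) ∂(stdGaussian (EuclideanSpace ℝ (Fin d))) =
      ENNReal.ofReal (‖x‖ ^ 4) * gaussianFourthMoment := by
  have hm : Measurable fun t : ℝ => ENNReal.ofReal (t ^ 4) := by fun_prop
  rw [← lintegral_map (f := fun t : ℝ => ENNReal.ofReal (t ^ 4)) hm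
    (g := fun v : EuclideanSpace ℝ (Fin d) => inner ℝ x v) (by fun_prop),
    map_inner_stdGaussian, lintegral_map hm (by fun_prop), gaussianFourthMoment,
    ← lintegral_const_mul _ hm]
  refine lintegral_congr fun t => ?_
  rw [mul_pow, ENNReal.ofReal_mul (by positivity)]

theorem integral_norm_sq_stdGaussian (d : ℕ) :
    ∫ v, ‖v‖ ^ 2 ∂(stdGaussian (EuclideanSpace ℝ (Fin d))) = d := by
  have hi : ∀ i : Fin d, Integrable (fun v : EuclideanSpace ℝ (Fin d) => v i ^ 2)
      (stdGaussian (EuclideanSpace ℝ (Fin d))) ∧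
      ∫ v, v i ^ 2 ∂(stdGaussian (EuclideanSpace ℝ (Fin d))) = 1 := by
    intro i
    have hlaw : (stdGaussian (EuclideanSpace ℝ (Fin d))).map (fun v => v i) =
        gaussianReal 0 1 := by
      have := map_inner_stdGaussian (EuclideanSpace.single i (1 : ℝ))
      simpa [EuclideanSpace.inner_single_left] using this
    have h2 : Integrable (fun t : ℝ => t ^ 2) (gaussianReal 0 1) := by
      have := (memLp_id_gaussianReal (μ := 0) (v := 1) 2).integrable_norm_pow (by norm_num)
      refine this.congr (ae_of_all _ fun t => ?_)
      simp
    have hmi : AEMeasurable (fun v : EuclideanSpace ℝ (Fin d) => v i)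
      (stdGaussian (EuclideanSpace ℝ (Fin d))) := by fun_prop
    constructor
    · rw [← hlaw] at h2
      exact h2.comp_aemeasurable hmi
    · have hv := variance_id_gaussianReal (μ := 0) (v := 1)
      rw [variance_of_integral_eq_zero (by fun_prop) (by simp)] at hv
      rw [← hlaw, integral_map hmi (by fun_prop)] at hv
      simpa using hv
  simp_rw [EuclideanSpace.real_norm_sq_eq]
  rw [integral_finsetSum _ fun i _ => (hi i).1]
  simp [fun i => (hi i).2]

theorem sq_dim_le_lintegral_norm_pow_four (d : ℕ) :
    ENNReal.ofReal ((d : ℝ) ^ 2) ≤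
      ∫⁻ v, ENNReal.ofReal (‖v‖ ^ 4) ∂(stdGaussian (EuclideanSpace ℝ (Fin d))) := by
  have hL : ∀ p : ℝ≥0∞, p ≠ ∞ → MemLp id p (stdGaussian (EuclideanSpace ℝ (Fin d))) :=
    fun p hp => IsGaussian.memLp_id _ p hp
  have h4 : Integrable (fun v : EuclideanSpace ℝ (Fin d) => ‖v‖ ^ 4)
      (stdGaussian (EuclideanSpace ℝ (Fin d))) :=
    (hL (4 : ℕ) (by norm_num)).integrable_norm_pow (by norm_num)
  have h2 : Integrable (fun v : EuclideanSpace ℝ (Fin d) => ‖v‖ ^ 2)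
      (stdGaussian (EuclideanSpace ℝ (Fin d))) :=
    (hL (2 : ℕ) (by norm_num)).integrable_norm_pow (by norm_num)
  rw [← ofReal_integral_eq_lintegral_ofReal h4 (ae_of_all _ fun v => by positivity)]
  refine ENNReal.ofReal_le_ofReal ?_
  have hle : ∫ v, (2 * d * ‖v‖ ^ 2 - d ^ 2) ∂(stdGaussian (EuclideanSpace ℝ (Fin d))) ≤
      ∫ v, ‖v‖ ^ 4 ∂(stdGaussian (EuclideanSpace ℝ (Fin d))) := by
    refine integral_mono ((h2.const_mul _).sub (integrable_const _)) h4 fun v => ?_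
    nlinarith [sq_nonneg (‖v‖ ^ 2 - d)]
  rw [integral_sub (h2.const_mul _) (integrable_const _), integral_const_mul,
    integral_norm_sq_stdGaussian] at hle
  simp at hle
  nlinarith

/-- If the law `π` of `x` is rotation invariant, then the fourth moment of `⟨x, v⟩`, weighted by a
function of `‖x‖`, is of order `‖v‖ ^ 4 * ‖x‖ ^ 4 / d ^ 2`. By rotation invariance it depends on
`‖v‖` only, so that it can be computed by averaging over a standard Gaussian `v`. -/
theorem lintegral_inner_pow_four_mul_le {d : ℕ} {π : Measure (EuclideanSpace ℝ (Fin d))}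
    [IsProbabilityMeasure π]
    (hπ : ∀ A : EuclideanSpace ℝ (Fin d) ≃ₗᵢ[ℝ] EuclideanSpace ℝ (Fin d), π.map A = π)
    {g : ℝ → ℝ≥0∞} (hg : Measurable g) (v : EuclideanSpace ℝ (Fin d)) :
    ENNReal.ofReal ((d : ℝ) ^ 2) * ∫⁻ x, ENNReal.ofReal (inner ℝ x v ^ 4) * g ‖x‖ ∂π ≤
      ENNReal.ofReal (‖v‖ ^ 4) *
        (gaussianFourthMoment * ∫⁻ x, ENNReal.ofReal (‖x‖ ^ 4) * g ‖x‖ ∂π) := by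
  set J : EuclideanSpace ℝ (Fin d) → ℝ≥0∞ :=
    fun v => ∫⁻ x, ENNReal.ofReal (inner ℝ x v ^ 4) * g ‖x‖ ∂π with hJ
  have hrot : ∀ v w, ‖v‖ = ‖w‖ → J v = J w := by
    intro v w hvw
    set A := Submodule.reflection (ℝ ∙ (v - w))ᗮ with hA
    have hAv : A v = w := Submodule.reflection_sub hvw
    simp only [hJ]
    conv_rhs => rw [← hπ A]
    rw [lintegral_map (by fun_prop) A.continuous.measurable, ← hAv]
    simp only [LinearIsometryEquiv.inner_map_map, LinearIsometryEquiv.norm_map]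
  have hscale : ∀ (c : ℝ) v, J (c • v) = ENNReal.ofReal (c ^ 4) * J v := by
    intro c v
    simp only [hJ]
    rw [← lintegral_const_mul _ (by fun_prop)]
    refine lintegral_congr fun x => ?_
    rw [inner_smul_right, mul_pow, ENNReal.ofReal_mul (Even.pow_nonneg (by decide) _), mul_assoc]
  have hmix : ∀ H, ENNReal.ofReal (‖H‖ ^ 4) * J v = ENNReal.ofReal (‖v‖ ^ 4) * J H := by
    intro H
    rw [← hscale, ← hscale]
    exact hrot _ _ (by rw [norm_smul, norm_smul, norm_norm, norm_norm, mul_comm])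
  have hJm : Measurable J := by
    have : Measurable fun z : EuclideanSpace ℝ (Fin d) × EuclideanSpace ℝ (Fin d) =>
        ENNReal.ofReal (inner ℝ z.2 z.1 ^ 4) * g ‖z.2‖ := by fun_prop
    exact this.lintegral_prod_right'
  have hJint : ∫⁻ H, J H ∂(stdGaussian (EuclideanSpace ℝ (Fin d))) =
      gaussianFourthMoment * ∫⁻ x, ENNReal.ofReal (‖x‖ ^ 4) * g ‖x‖ ∂π := by
    simp only [hJ]
    rw [lintegral_lintegral_swap (by fun_prop), ← lintegral_const_mul _ (by fun_prop)]
    refine lintegral_congr fun x => ?_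
    rw [lintegral_mul_const _ (by fun_prop), lintegral_inner_pow_four_stdGaussian]
    ring
  calc _ ≤ (∫⁻ H, ENNReal.ofReal (‖H‖ ^ 4) ∂(stdGaussian (EuclideanSpace ℝ (Fin d)))) * J v := by
        gcongr; exact sq_dim_le_lintegral_norm_pow_four d
    _ = ∫⁻ H, ENNReal.ofReal (‖H‖ ^ 4) * J v ∂(stdGaussian (EuclideanSpace ℝ (Fin d))) :=
        (lintegral_mul_const _ (by fun_prop)).symm
    _ = ENNReal.ofReal (‖v‖ ^ 4) * ∫⁻ H, J H ∂(stdGaussian (EuclideanSpace ℝ (Fin d))) := by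
        simp_rw [hmix]; exact lintegral_const_mul _ hJm
    _ = _ := by rw [hJint]

/-! ### Detailed balance for the random-walk Metropolis chain -/

instance : IsProbabilityMeasure ((volume : Measure ℝ).restrict (Icc 0 1)) := ⟨by simp⟩

/-- One Metropolis step as a function of the state, the proposed increment and the uniform
variable. -/
noncomputable def metropolisUpdate (Q : Measure ℝ) (d : ℕ)
    (z : EuclideanSpace ℝ (Fin d) × (EuclideanSpace ℝ (Fin d) × ℝ)) : EuclideanSpace ℝ (Fin d) :=
  if z.2.2 ≤ acceptProb Q d z.1 (z.1 + z.2.1) then z.1 + z.2.1 else z.1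

section Reversible

variable (Q : Measure ℝ) [IsProbabilityMeasure Q] {d : ℕ}

theorem measurable_acceptProb : Measurable fun z : EuclideanSpace ℝ (Fin d) ×
    EuclideanSpace ℝ (Fin d) => acceptProb Q d z.1 z.2 := by
  have := measurable_targetDensity Q d
  unfold acceptProb
  fun_prop

theorem measurable_acceptProb_add : Measurable fun z : EuclideanSpace ℝ (Fin d) ×
    EuclideanSpace ℝ (Fin d) => acceptProb Q d z.1 (z.1 + z.2) :=
  (measurable_acceptProb Q).comp (f := fun z : EuclideanSpace ℝ (Fin d) ×
    EuclideanSpace ℝ (Fin d) => (z.1, z.1 + z.2)) (by fun_prop)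

theorem measurable_metropolisUpdate : Measurable (metropolisUpdate Q d) := by
  have h : Measurable fun z : EuclideanSpace ℝ (Fin d) × (EuclideanSpace ℝ (Fin d) × ℝ) =>
      acceptProb Q d z.1 (z.1 + z.2.1) :=
    (measurable_acceptProb_add Q).comp (f := fun z : EuclideanSpace ℝ (Fin d) ×
      (EuclideanSpace ℝ (Fin d) × ℝ) => (z.1, z.2.1)) (by fun_prop)
  exact Measurable.ite (measurableSet_le (by fun_prop) h) (by fun_prop) (by fun_prop)

omit [IsProbabilityMeasure Q] in
theorem ofReal_acceptProb (x y : EuclideanSpace ℝ (Fin d)) :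
    ENNReal.ofReal (acceptProb Q d x y) =
      min 1 (targetDensity Q d y / targetDensity Q d x) :=
  ENNReal.ofReal_toReal (ne_top_of_le_ne_top ENNReal.one_ne_top (min_le_left _ _))

omit [IsProbabilityMeasure Q] in
theorem acceptProb_mem_Icc (x y : EuclideanSpace ℝ (Fin d)) : acceptProb Q d x y ∈ Icc 0 1 := by
  refine ⟨ENNReal.toReal_nonneg, ?_⟩
  have := ENNReal.toReal_mono ENNReal.one_ne_top
    (min_le_left 1 (targetDensity Q d y / targetDensity Q d x))
  simpa [acceptProb] using this

theorem lintegral_uniform_ite {β : Type*} (φ : β → ℝ≥0∞) {a : ℝ} (ha : a ∈ Icc (0 : ℝ) 1)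
    (y x : β) :
    ∫⁻ u in Icc (0 : ℝ) 1, φ (if u ≤ a then y else x) =
      ENNReal.ofReal a * φ y + ENNReal.ofReal (1 - a) * φ x := by
  have e : ∀ u, φ (if u ≤ a then y else x) =
      (Iic a).indicator (fun _ => φ y) u + (Ioi a).indicator (fun _ => φ x) u := by
    intro u
    by_cases h : u ≤ a
    · simp [h]
    · simp [h, not_le.1 h]
  simp_rw [e]
  rw [lintegral_add_left (measurable_const.indicator measurableSet_Iic),
    lintegral_indicator_const measurableSet_Iic, lintegral_indicator_const measurableSet_Ioi,
    Measure.restrict_apply measurableSet_Iic, Measure.restrict_apply measurableSet_Ioi]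
  have h1 : Iic a ∩ Icc (0 : ℝ) 1 = Icc 0 a := by
    ext u; simp only [mem_inter_iff, mem_Iic, mem_Icc]; have := ha.2
    constructor
    · rintro ⟨h1, h2, h3⟩; exact ⟨h2, h1⟩
    · rintro ⟨h1, h2⟩; exact ⟨h2, h1, h2.trans this⟩
  have h2 : Ioi a ∩ Icc (0 : ℝ) 1 = Ioc a 1 := by
    ext u; simp only [mem_inter_iff, mem_Ioi, mem_Icc, mem_Ioc]; have := ha.1
    constructor
    · rintro ⟨h1, h2, h3⟩; exact ⟨h1, h3⟩
    · rintro ⟨h1, h2⟩; exact ⟨h1, this.trans h1.le, h2⟩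
  rw [h1, h2, Real.volume_Icc, Real.volume_Ioc, sub_zero, mul_comm, mul_comm (φ x)]

variable {Q} (hQ : ∀ᵐ y ∂Q, 0 < y)
include hQ

/-- The flux of accepted moves is symmetric: `p x * min 1 (p y / p x) = min (p x) (p y)`, and
Lebesgue measure is translation invariant. -/
theorem lintegral_acceptProb_symm {Γ : Measure (EuclideanSpace ℝ (Fin d))}
    [IsProbabilityMeasure Γ] (hΓ : Γ.map (fun w => -w) = Γ)
    {F : EuclideanSpace ℝ (Fin d) × EuclideanSpace ℝ (Fin d) → ℝ≥0∞} (hF : Measurable F) :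
    ∫⁻ x, ∫⁻ w, ENNReal.ofReal (acceptProb Q d x (x + w)) * F (x, x + w) ∂Γ ∂(targetLaw Q d) =
    ∫⁻ x, ∫⁻ w, ENNReal.ofReal (acceptProb Q d x (x + w)) * F (x + w, x) ∂Γ
      ∂(targetLaw Q d) := by
  set p := targetDensity Q d with hp
  have hpm : Measurable p := measurable_targetDensity Q d
  have flux : ∀ G : EuclideanSpace ℝ (Fin d) × EuclideanSpace ℝ (Fin d) → ℝ≥0∞, Measurable G →
      ∫⁻ x, ∫⁻ w, ENNReal.ofReal (acceptProb Q d x (x + w)) * G (x, x + w) ∂Γ ∂(targetLaw Q d) =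
      ∫⁻ w, (∫⁻ x, min (p x) (p (x + w)) * G (x, x + w)) ∂Γ := by
    intro G hG
    have hm : Measurable fun z : EuclideanSpace ℝ (Fin d) × EuclideanSpace ℝ (Fin d) =>
        ENNReal.ofReal (acceptProb Q d z.1 (z.1 + z.2)) * G (z.1, z.1 + z.2) := by
      have := measurable_acceptProb_add Q (d := d)
      fun_prop
    have hm2 : Measurable fun z : EuclideanSpace ℝ (Fin d) × EuclideanSpace ℝ (Fin d) =>
        min (p z.2) (p (z.2 + z.1)) * G (z.2, z.2 + z.1) := by fun_prop
    rw [targetLaw_eq_withDensity d hQ,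
      lintegral_withDensity_eq_lintegral_mul _ hpm hm.lintegral_prod_right',
      lintegral_lintegral_swap hm2.aemeasurable]
    refine lintegral_congr_ae ?_
    filter_upwards [ae_targetDensity_lt_top d hQ] with x hx
    have hmx : Measurable fun w => ENNReal.ofReal (acceptProb Q d x (x + w)) * G (x, x + w) :=
      hm.comp (f := fun w => (x, w)) measurable_prodMk_left
    rw [Pi.mul_apply, ← lintegral_const_mul _ hmx]
    refine lintegral_congr fun w => ?_
    rw [← mul_assoc, ofReal_acceptProb, mul_min, mul_one,
      ENNReal.mul_div_cancel (targetDensity_pos d hQ x).ne' hx.ne]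
  rw [flux F hF, flux (fun z => F (z.2, z.1)) (by fun_prop)]
  have hH : Measurable fun w => ∫⁻ x, min (p x) (p (x + w)) * F (x, x + w) := by
    have : Measurable fun z : EuclideanSpace ℝ (Fin d) × EuclideanSpace ℝ (Fin d) =>
        min (p z.2) (p (z.2 + z.1)) * F (z.2, z.2 + z.1) := by fun_prop
    exact this.lintegral_prod_right'
  conv_lhs => rw [← hΓ]
  rw [lintegral_map hH (g := fun w => -w) measurable_neg]
  refine lintegral_congr fun w => ?_
  rw [← lintegral_add_right_eq_self _ w]
  refine lintegral_congr fun x => ?_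
  simp only [add_neg_cancel_right, min_comm]

omit hQ in
theorem lintegral_metropolisUpdate {π Γ : Measure (EuclideanSpace ℝ (Fin d))}
    [IsProbabilityMeasure π] [IsProbabilityMeasure Γ]
    {G : EuclideanSpace ℝ (Fin d) × EuclideanSpace ℝ (Fin d) → ℝ≥0∞} (hG : Measurable G) :
    ∫⁻ z, G (z.1, metropolisUpdate Q d z) ∂(π.prod (Γ.prod (volume.restrict (Icc 0 1)))) =
      (∫⁻ x, ∫⁻ w, ENNReal.ofReal (acceptProb Q d x (x + w)) * G (x, x + w) ∂Γ ∂π) +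
      ∫⁻ x, ∫⁻ w, ENNReal.ofReal (1 - acceptProb Q d x (x + w)) * G (x, x) ∂Γ ∂π := by
  have hm1 : Measurable fun z : EuclideanSpace ℝ (Fin d) × EuclideanSpace ℝ (Fin d) =>
      ENNReal.ofReal (acceptProb Q d z.1 (z.1 + z.2)) * G (z.1, z.1 + z.2) := by
    have := measurable_acceptProb_add Q (d := d)
    fun_prop
  have hGm : Measurable fun z => G (z.1, metropolisUpdate Q d z) :=
    hG.comp (measurable_fst.prodMk (measurable_metropolisUpdate Q))
  have step : ∀ x w, ∫⁻ u in Icc (0 : ℝ) 1, G (x, metropolisUpdate Q d (x, (w, u))) =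
      ENNReal.ofReal (acceptProb Q d x (x + w)) * G (x, x + w) +
      ENNReal.ofReal (1 - acceptProb Q d x (x + w)) * G (x, x) := fun x w =>
    lintegral_uniform_ite (fun y => G (x, y)) (acceptProb_mem_Icc Q x (x + w)) (x + w) x
  have inner : ∀ x, ∫⁻ v, G (x, metropolisUpdate Q d (x, v))
        ∂(Γ.prod (volume.restrict (Icc 0 1))) =
      (∫⁻ w, ENNReal.ofReal (acceptProb Q d x (x + w)) * G (x, x + w) ∂Γ) +
      ∫⁻ w, ENNReal.ofReal (1 - acceptProb Q d x (x + w)) * G (x, x) ∂Γ := by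
    intro x
    have hGx : Measurable fun v => G (x, metropolisUpdate Q d (x, v)) :=
      hGm.comp (f := fun v => (x, v)) measurable_prodMk_left
    have hm1x : Measurable fun w =>
        ENNReal.ofReal (acceptProb Q d x (x + w)) * G (x, x + w) :=
      hm1.comp (f := fun w => (x, w)) measurable_prodMk_left
    rw [lintegral_prod _ hGx.aemeasurable]
    simp_rw [step]
    rw [lintegral_add_left hm1x]
  rw [lintegral_prod _ hGm.aemeasurable]
  simp_rw [inner]
  rw [lintegral_add_left hm1.lintegral_prod_right']

theorem map_metropolisUpdate_symm {Γ : Measure (EuclideanSpace ℝ (Fin d))}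
    [IsProbabilityMeasure Γ] (hΓ : Γ.map (fun w => -w) = Γ) :
    ((targetLaw Q d).prod (Γ.prod (volume.restrict (Icc 0 1)))).map
        (fun z => (metropolisUpdate Q d z, z.1)) =
      ((targetLaw Q d).prod (Γ.prod (volume.restrict (Icc 0 1)))).map
        (fun z => (z.1, metropolisUpdate Q d z)) := by
  have hΦ := measurable_metropolisUpdate Q (d := d)
  refine Measure.ext_of_lintegral _ fun F hF => ?_
  rw [lintegral_map hF (hΦ.prodMk measurable_fst), lintegral_map hF (measurable_fst.prodMk hΦ),
    lintegral_metropolisUpdate hF,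
    lintegral_metropolisUpdate (G := fun z => F (z.2, z.1)) (by fun_prop),
    lintegral_acceptProb_symm hQ hΓ hF]

omit hQ in
theorem map_neg_eq_of_symm {Γ : Measure (EuclideanSpace ℝ (Fin d))}
    (hΓ : ∀ A, MeasurableSet A → Γ A = Γ (-A)) : Γ.map (fun w => -w) = Γ := by
  ext A hA
  rw [Measure.map_apply measurable_neg hA]
  exact (hΓ A hA).symm

theorem IsStationaryRWM.isReversibleRecursion {Γ : Measure (EuclideanSpace ℝ (Fin d))}
    [IsProbabilityMeasure Γ] (hΓ : ∀ A, MeasurableSet A → Γ A = Γ (-A))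
    {Ω : Type*} [MeasurableSpace Ω] {μ : Measure Ω} [IsProbabilityMeasure μ]
    {X W : ℕ → Ω → EuclideanSpace ℝ (Fin d)} {U : ℕ → Ω → ℝ}
    (h : IsStationaryRWM Q d Γ μ X W U) :
    IsReversibleRecursion (metropolisUpdate Q d) (targetLaw Q d)
      (Γ.prod (volume.restrict (Icc 0 1))) μ X (fun m ω => (W m ω, U m ω)) where
  measurable_update := measurable_metropolisUpdate Q
  law_init := h.law_init
  law_noise m := (h.indep_increment_uniform m).hasLaw_prod (h.law_increment m) (h.law_uniform m)
  indep_init := h.indep_init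
  indep_noise := h.indep_steps
  step := h.step
  reversible := map_metropolisUpdate_symm hQ (map_neg_eq_of_symm hΓ)

end Reversible

/-! ### The size of one step -/

/-- A bounded decreasing function of the scaled squared norm `‖x‖ ^ 2 / d`, through which the chain
is observed. -/
noncomputable def invNormObservable (d : ℕ) (x : EuclideanSpace ℝ (Fin d)) : ℝ :=
  (1 + ‖x‖ ^ 2 / d)⁻¹

theorem isBoundedMeasurable_invNormObservable (d : ℕ) :
    IsBoundedMeasurable (invNormObservable d) := by
  refine ⟨by unfold invNormObservable; fun_prop, 1, fun x => ?_⟩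
  have h : 0 ≤ ‖x‖ ^ 2 / d := by positivity
  rw [invNormObservable, abs_of_nonneg (by positivity)]
  exact inv_le_one_of_one_le₀ (by linarith)

/-- However large the increment `w`, a move decreases the squared norm by at most the squared
component of `x` in the direction of `w`, since `-2 ⟪x, w⟫ - ‖w‖ ^ 2 ≤ ⟪x, w / ‖w‖⟫ ^ 2`. -/
theorem norm_sq_sub_norm_add_sq_le {E : Type*} [NormedAddCommGroup E] [InnerProductSpace ℝ E]
    (x w : E) : ‖x‖ ^ 2 - ‖x + w‖ ^ 2 ≤ inner ℝ x (‖w‖⁻¹ • w) ^ 2 := by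
  rw [norm_add_sq_real, inner_smul_right]
  rcases eq_or_ne w 0 with rfl | hw
  · simp
  · have hw' : ‖w‖ ≠ 0 := norm_ne_zero_iff.2 hw
    have : inner ℝ x w = ‖w‖ * (‖w‖⁻¹ * inner ℝ x w) := by field_simp
    nlinarith [sq_nonneg (‖w‖ + ‖w‖⁻¹ * inner ℝ x w)]

theorem invNormObservable_add_sub_le {d : ℕ} (x w : EuclideanSpace ℝ (Fin d)) :
    invNormObservable d (x + w) - invNormObservable d x ≤
      inner ℝ x (‖w‖⁻¹ • w) ^ 2 / d * (1 + ‖x‖ ^ 2 / d)⁻¹ := by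
  unfold invNormObservable
  set r := ‖x‖ ^ 2 / (d : ℝ) with hr
  set s := ‖x + w‖ ^ 2 / (d : ℝ) with hs
  have hr0 : 0 ≤ r := by positivity
  have hs0 : 0 ≤ s := by positivity
  have h1 : r - s ≤ inner ℝ x (‖w‖⁻¹ • w) ^ 2 / d := by
    rw [hr, hs, ← sub_div]
    exact div_le_div_of_nonneg_right (norm_sq_sub_norm_add_sq_le x w) (Nat.cast_nonneg d)
  have h2 : 0 ≤ inner ℝ x (‖w‖⁻¹ • w) ^ 2 / (d : ℝ) := by positivity
  have e : (1 + s)⁻¹ - (1 + r)⁻¹ = (r - s) * (1 + s)⁻¹ * (1 + r)⁻¹ := by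
    field_simp; ring
  rw [e]
  refine mul_le_mul_of_nonneg_right ?_ (by positivity)
  have h3 : (1 + s)⁻¹ ≤ 1 := inv_le_one_of_one_le₀ (by linarith)
  have h4 : 0 ≤ (1 + s)⁻¹ := by positivity
  nlinarith

section Step

variable {Q : Measure ℝ} [IsProbabilityMeasure Q] {d : ℕ}

theorem lintegral_inner_weight_le (hd : 1 ≤ d) {v : EuclideanSpace ℝ (Fin d)} (hv : ‖v‖ ≤ 1) :
    ∫⁻ x, ENNReal.ofReal ((inner ℝ x v ^ 2 / d * (1 + ‖x‖ ^ 2 / d)⁻¹) ^ 2) ∂(targetLaw Q d) ≤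
      gaussianFourthMoment * ENNReal.ofReal (((d : ℝ) ^ 2)⁻¹) := by
  have hd0 : (0 : ℝ) < d := by exact_mod_cast hd
  set g : ℝ → ℝ≥0∞ := fun r => ENNReal.ofReal ((d + r ^ 2)⁻¹ ^ 2) with hg
  have key := lintegral_inner_pow_four_mul_le (π := targetLaw Q d)
    (targetLaw_map_linearIsometryEquiv Q) (g := g) (by fun_prop) v
  have e : ∀ x : EuclideanSpace ℝ (Fin d),
      ENNReal.ofReal ((inner ℝ x v ^ 2 / d * (1 + ‖x‖ ^ 2 / d)⁻¹) ^ 2) =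
        ENNReal.ofReal (inner ℝ x v ^ 4) * g ‖x‖ := by
    intro x
    rw [hg, ← ENNReal.ofReal_mul (Even.pow_nonneg (by decide) _)]
    congr 1
    have : (d : ℝ) + ‖x‖ ^ 2 ≠ 0 := by positivity
    field_simp
  have hle : ∫⁻ x, ENNReal.ofReal (‖x‖ ^ 4) * g ‖x‖ ∂(targetLaw Q d) ≤ 1 := by
    calc _ ≤ ∫⁻ _, 1 ∂(targetLaw Q d) := by
          refine lintegral_mono fun x => ?_
          rw [hg, ← ENNReal.ofReal_mul (by positivity), ENNReal.ofReal_le_one]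
          rw [inv_pow, ← div_eq_mul_inv, div_le_one (by positivity)]
          nlinarith [sq_nonneg ‖x‖]
      _ = 1 := by simp
  simp_rw [e]
  have hv4 : ENNReal.ofReal (‖v‖ ^ 4) ≤ 1 := by
    rw [ENNReal.ofReal_le_one]; exact pow_le_one₀ (norm_nonneg _) hv
  have h1 : ENNReal.ofReal ((d : ℝ) ^ 2) *
      ∫⁻ x, ENNReal.ofReal (inner ℝ x v ^ 4) * g ‖x‖ ∂(targetLaw Q d) ≤ gaussianFourthMoment := by
    refine key.trans ?_
    calc _ ≤ 1 * (gaussianFourthMoment * 1) := by gcongr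
      _ = _ := by simp
  rw [ENNReal.ofReal_inv_of_pos (by positivity), ← div_eq_mul_inv,
    ENNReal.le_div_iff_mul_le (Or.inl (by simpa using (by omega : d ≠ 0)))
      (Or.inl ENNReal.ofReal_ne_top), mul_comm]
  exact h1

/-- The mean square of one step of the observed chain is of order `d⁻²`. By reversibility it is
twice the contribution of the moves that decrease the norm, which is controlled without any
information on the increment law or on the acceptance probability. -/
theorem integral_sq_invNormObservable_step_le (hQ : ∀ᵐ y ∂Q, 0 < y) (hd : 1 ≤ d)
    {Γ : Measure (EuclideanSpace ℝ (Fin d))} [IsProbabilityMeasure Γ]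
    (hΓ : ∀ A, MeasurableSet A → Γ A = Γ (-A)) :
    ∫ z, (invNormObservable d (metropolisUpdate Q d z) - invNormObservable d z.1) ^ 2
        ∂((targetLaw Q d).prod (Γ.prod (volume.restrict (Icc 0 1)))) ≤
      2 * gaussianFourthMoment.toReal / (d : ℝ) ^ 2 := by
  set ρ := (targetLaw Q d).prod (Γ.prod ((volume : Measure ℝ).restrict (Icc 0 1))) with hρ
  have hh := (isBoundedMeasurable_invNormObservable d).1
  have hΦ := measurable_metropolisUpdate Q (d := d)
  set F : EuclideanSpace ℝ (Fin d) × EuclideanSpace ℝ (Fin d) → ℝ≥0∞ := fun p =>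
    ENNReal.ofReal (max (invNormObservable d p.2 - invNormObservable d p.1) 0 ^ 2) with hF
  have hFm : Measurable F := by fun_prop
  have hsplit : ∀ x y, ENNReal.ofReal ((invNormObservable d y - invNormObservable d x) ^ 2) =
      F (x, y) + F (y, x) := by
    intro x y
    rw [hF, ← ENNReal.ofReal_add (by positivity) (by positivity)]
    congr 1
    rcases le_total (invNormObservable d x) (invNormObservable d y) with h | h
    · rw [max_eq_left (by linarith), max_eq_right (by linarith)]; ring
    · rw [max_eq_right (by linarith), max_eq_left (by linarith)]; ring
  have hsymm : ∫⁻ z, F (metropolisUpdate Q d z, z.1) ∂ρ =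
      ∫⁻ z, F (z.1, metropolisUpdate Q d z) ∂ρ := by
    have h := map_metropolisUpdate_symm hQ (d := d) (map_neg_eq_of_symm hΓ)
    rw [← lintegral_map hFm (hΦ.prodMk measurable_fst), h,
      lintegral_map hFm (measurable_fst.prodMk hΦ)]
  have hbound : ∫⁻ z, F (z.1, metropolisUpdate Q d z) ∂ρ ≤
      gaussianFourthMoment * ENNReal.ofReal (((d : ℝ) ^ 2)⁻¹) := by
    have hGm : Measurable fun z : EuclideanSpace ℝ (Fin d) × (EuclideanSpace ℝ (Fin d) × ℝ) =>
        ENNReal.ofReal ((inner ℝ z.1 (‖z.2.1‖⁻¹ • z.2.1) ^ 2 / d *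
          (1 + ‖z.1‖ ^ 2 / d)⁻¹) ^ 2) := by fun_prop
    calc _ ≤ ∫⁻ z, ENNReal.ofReal ((inner ℝ z.1 (‖z.2.1‖⁻¹ • z.2.1) ^ 2 / d *
          (1 + ‖z.1‖ ^ 2 / d)⁻¹) ^ 2) ∂ρ := by
          refine lintegral_mono fun z => ENNReal.ofReal_le_ofReal ?_
          refine pow_le_pow_left₀ (le_max_right _ _) (max_le ?_ (by positivity)) 2
          unfold metropolisUpdate
          split_ifs
          · exact invNormObservable_add_sub_le _ _
          · rw [sub_self]; positivity
      _ = ∫⁻ v, ∫⁻ x, ENNReal.ofReal ((inner ℝ x (‖v.1‖⁻¹ • v.1) ^ 2 / d *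
          (1 + ‖x‖ ^ 2 / d)⁻¹) ^ 2) ∂(targetLaw Q d)
            ∂(Γ.prod ((volume : Measure ℝ).restrict (Icc 0 1))) :=
          lintegral_prod_symm' _ hGm
      _ ≤ ∫⁻ _, gaussianFourthMoment * ENNReal.ofReal (((d : ℝ) ^ 2)⁻¹)
            ∂(Γ.prod ((volume : Measure ℝ).restrict (Icc 0 1))) := by
          refine lintegral_mono fun v => lintegral_inner_weight_le hd ?_
          rw [norm_smul, norm_inv, norm_norm]
          exact inv_mul_le_one
      _ = _ := by simp
  have hfin : gaussianFourthMoment * ENNReal.ofReal (((d : ℝ) ^ 2)⁻¹) ≠ ∞ :=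
    ENNReal.mul_ne_top gaussianFourthMoment_lt_top.ne ENNReal.ofReal_ne_top
  have hsq : Measurable fun z : EuclideanSpace ℝ (Fin d) × (EuclideanSpace ℝ (Fin d) × ℝ) =>
      (invNormObservable d (metropolisUpdate Q d z) - invNormObservable d z.1) ^ 2 := by fun_prop
  rw [integral_eq_lintegral_of_nonneg_ae (ae_of_all _ fun _ => sq_nonneg _)
    hsq.aestronglyMeasurable]
  simp_rw [hsplit]
  have hF1 : Measurable fun z => F (z.1, metropolisUpdate Q d z) :=
    hFm.comp (measurable_fst.prodMk hΦ)
  rw [lintegral_add_left hF1, hsymm, ← two_mul,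
    ENNReal.toReal_mul]
  refine (mul_le_mul_of_nonneg_left (ENNReal.toReal_mono hfin hbound)
    ENNReal.toReal_nonneg).trans_eq ?_
  rw [ENNReal.toReal_mul, ENNReal.toReal_ofReal (by positivity)]
  simp only [ENNReal.toReal_ofNat]
  ring

end Step

/-! ### From the observable back to the squared norm -/

theorem targetLaw_norm_sq_gt_le (Q : Measure ℝ) [IsProbabilityMeasure Q] {d : ℕ} (hd : 1 ≤ d)
    {L : ℝ} (hL : 0 < L) :
    targetLaw Q d {x | L ^ 2 < ‖x‖ ^ 2 / d} ≤ Q (Ioi L) + ENNReal.ofReal L⁻¹ := by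
  have hd0 : (0 : ℝ) < d := by exact_mod_cast hd
  set G := stdGaussian (EuclideanSpace ℝ (Fin d)) with hG
  have hS : MeasurableSet {x : EuclideanSpace ℝ (Fin d) | L ^ 2 < ‖x‖ ^ 2 / d} :=
    measurableSet_lt (by fun_prop) (by fun_prop)
  have hsub : (fun z : ℝ × EuclideanSpace ℝ (Fin d) => √z.1 • z.2) ⁻¹'
      {x | L ^ 2 < ‖x‖ ^ 2 / d} ⊆ (Ioi L ×ˢ univ) ∪ (univ ×ˢ {g | L ≤ ‖g‖ ^ 2 / d}) := by
    rintro ⟨y, g⟩ hz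
    simp only [mem_preimage, mem_ofPred_eq, norm_smul, mul_pow, Real.norm_eq_abs, sq_abs] at hz
    simp only [mem_union, mem_prod, mem_Ioi, mem_univ, and_true, true_and, mem_ofPred_eq]
    by_contra! hcon
    obtain ⟨h1, h2⟩ := hcon
    have h3 : √y ^ 2 ≤ L := by
      rcases le_total 0 y with h | h
      · rwa [Real.sq_sqrt h]
      · rw [Real.sqrt_eq_zero_of_nonpos h]; simpa using hL.le
    have h4 : √y ^ 2 * (‖g‖ ^ 2 / d) ≤ L * L :=
      mul_le_mul h3 h2.le (by positivity) hL.le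
    rw [mul_div_assoc] at hz
    nlinarith
  have hint : Integrable (fun v : EuclideanSpace ℝ (Fin d) => ‖v‖ ^ 2 / d) G :=
    ((IsGaussian.memLp_id G ((2 : ℕ) : ℝ≥0∞) (by norm_num)).integrable_norm_pow
      (by norm_num)).div_const _
  have hmarkov : G {g | L ≤ ‖g‖ ^ 2 / d} ≤ ENNReal.ofReal L⁻¹ := by
    have h1 := mul_meas_ge_le_integral_of_nonneg (ae_of_all _ fun v => by positivity) hint L
    rw [integral_div, integral_norm_sq_stdGaussian, div_self hd0.ne'] at h1
    rw [← ofReal_measureReal]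
    refine ENNReal.ofReal_le_ofReal ?_
    rw [← one_div, le_div_iff₀' hL]
    exact h1
  calc targetLaw Q d {x | L ^ 2 < ‖x‖ ^ 2 / d}
      = (Q.prod G) ((fun z : ℝ × EuclideanSpace ℝ (Fin d) => √z.1 • z.2) ⁻¹'
          {x | L ^ 2 < ‖x‖ ^ 2 / d}) := Measure.map_apply (measurable_sqrt_smul d) hS
    _ ≤ (Q.prod G) (Ioi L ×ˢ univ) + (Q.prod G) (univ ×ˢ {g | L ≤ ‖g‖ ^ 2 / d}) :=
      (measure_mono hsub).trans (measure_union_le _ _)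
    _ ≤ _ := by
      rw [Measure.prod_prod, Measure.prod_prod]
      simpa using add_le_add (le_refl (Q (Ioi L))) hmarkov

theorem tendsto_measure_Ioi_atTop (Q : Measure ℝ) [IsFiniteMeasure Q] :
    Tendsto (fun L : ℝ => Q (Ioi L)) atTop (𝓝 0) := by
  have h := tendsto_measure_iInter_atTop (μ := Q) (s := fun L : ℝ => Ioi L)
    (fun L => measurableSet_Ioi.nullMeasurableSet) (fun a b hab => Ioi_subset_Ioi hab)
    ⟨0, measure_ne_top _ _⟩
  have e : ⋂ L : ℝ, Ioi L = ∅ := by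
    ext x; simpa using ⟨x, le_refl x⟩
  rwa [e, measure_empty] at h

/-- The derivative of `r ↦ (1 + r)⁻¹` is bounded below on bounded sets, and closeness of the values
keeps `s` in a bounded set when `r` is. -/
theorem abs_sub_le_of_abs_inv_sub_lt {r s K η κ : ℝ} (hr : 0 ≤ r) (hs : 0 ≤ s) (hrK : r ≤ K)
    (h : |(1 + s)⁻¹ - (1 + r)⁻¹| < η) (hη1 : η ≤ (2 * (1 + K))⁻¹)
    (hη2 : η ≤ κ / (2 * (1 + K) ^ 2)) : |s - r| ≤ κ := by
  have hK : 0 < 1 + K := by linarith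
  have hr1 : (1 + K)⁻¹ ≤ (1 + r)⁻¹ := inv_anti₀ (by linarith) (by linarith)
  have hs1 : (2 * (1 + K))⁻¹ ≤ (1 + s)⁻¹ := by
    have h1 := (abs_lt.1 h).1
    have e : (1 + K)⁻¹ = 2 * (2 * (1 + K))⁻¹ := by field_simp
    linarith
  have hs2 : 1 + s ≤ 2 * (1 + K) := (inv_le_inv₀ (by positivity) (by linarith)).1 hs1
  have e : |s - r| = |(1 + s)⁻¹ - (1 + r)⁻¹| * ((1 + r) * (1 + s)) := by
    have h0 : (0 : ℝ) ≤ (1 + r) * (1 + s) := by positivity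
    conv_rhs => rw [← abs_of_nonneg h0, ← abs_mul, ← abs_neg]
    congr 1
    field_simp
    ring
  rw [e]
  calc |(1 + s)⁻¹ - (1 + r)⁻¹| * ((1 + r) * (1 + s))
      ≤ κ / (2 * (1 + K) ^ 2) * ((1 + K) * (2 * (1 + K))) :=
        mul_le_mul (h.le.trans hη2) (mul_le_mul (by linarith) hs2 (by linarith) hK.le)
          (by positivity) ((abs_nonneg _).trans (h.le.trans hη2))
    _ = κ := by field_simp

theorem supOscillation_scaledSqNorm_le {d : ℕ} {a T κ : ℝ} (ha : 0 ≤ a)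
    {x : ℕ → EuclideanSpace ℝ (Fin d)}
    (h : ∀ m ≤ ⌊T * a⌋₊, |‖x m‖ ^ 2 / d - ‖x 0‖ ^ 2 / d| ≤ κ) :
    supOscillation (scaledSqNorm a x) T ≤ ENNReal.ofReal (2 * κ) := by
  refine iSup₂_le fun s hs => iSup₂_le fun t ht => ENNReal.ofReal_le_ofReal ?_
  have hle : ∀ t ∈ Icc 0 T, |scaledSqNorm a x t - ‖x 0‖ ^ 2 / d| ≤ κ := fun t ht =>
    h _ (Nat.floor_le_floor (mul_le_mul_of_nonneg_right ht.2 ha))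
  have h1 := hle s hs
  have h2 := hle t ht
  rw [abs_sub_comm] at h1
  linarith [abs_sub_le (scaledSqNorm a x t) (‖x 0‖ ^ 2 / d) (scaledSqNorm a x s)]

/-- The estimate at fixed dimension: `L` truncates the initial state, `2 ^ N` bounds the number of
steps. -/
theorem IsStationaryRWM.measure_supOscillation_ge_le {Q : Measure ℝ} [IsProbabilityMeasure Q]
    (hQ : ∀ᵐ y ∂Q, 0 < y) {d : ℕ} (hd : 1 ≤ d) {Γ : Measure (EuclideanSpace ℝ (Fin d))}
    [IsProbabilityMeasure Γ] (hΓ : ∀ A, MeasurableSet A → Γ A = Γ (-A))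
    {Ω : Type*} [MeasurableSpace Ω] {μ : Measure Ω} [IsProbabilityMeasure μ]
    {X W : ℕ → Ω → EuclideanSpace ℝ (Fin d)} {U : ℕ → Ω → ℝ}
    (h : IsStationaryRWM Q d Γ μ X W U) {a T δ L η : ℝ} (ha : 0 ≤ a) (hδ : 0 < δ) (hL : 0 < L)
    (hη : 0 < η) (hη1 : η ≤ (2 * (1 + L ^ 2))⁻¹) (hη2 : η ≤ δ / 4 / (2 * (1 + L ^ 2) ^ 2))
    {N : ℕ} (hN : ⌊T * a⌋₊ ≤ 2 ^ N) :
    μ {ω | ENNReal.ofReal δ ≤ supOscillation (scaledSqNorm a (fun m => X m ω)) T} ≤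
      (Q (Ioi L) + ENNReal.ofReal L⁻¹) + ENNReal.ofReal
        ((N + 1) ^ 2 * 2 ^ N / (d : ℝ) ^ 2 * (2 * gaussianFourthMoment.toReal / η ^ 2)) := by
  have hrec := h.isReversibleRecursion hQ hΓ
  have hb := isBoundedMeasurable_invNormObservable d
  have hS : MeasurableSet {x : EuclideanSpace ℝ (Fin d) | L ^ 2 < ‖x‖ ^ 2 / d} :=
    measurableSet_lt (by fun_prop) (by fun_prop)
  have hinit : μ {ω | L ^ 2 < ‖X 0 ω‖ ^ 2 / d} ≤ Q (Ioi L) + ENNReal.ofReal L⁻¹ :=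
    (h.law_init.measure_eq hS).trans_le (targetLaw_norm_sq_gt_le Q hd hL)
  have hmax := measure_exists_le_abs_sub_zero_le (μ := μ)
    (Y := fun m ω => invNormObservable d (X m ω))
    (σ := 2 * gaussianFourthMoment.toReal / (d : ℝ) ^ 2)
    (fun i j => hrec.integrable_sq_sub hb i j)
    (fun i k => (hrec.integral_sq_sub_le hb i k).trans
      (mul_le_mul_of_nonneg_left (integral_sq_invNormObservable_step_le hQ hd hΓ)
        (Nat.cast_nonneg k))) N hη
  have hsub : {ω | ENNReal.ofReal δ ≤ supOscillation (scaledSqNorm a (fun m => X m ω)) T} ⊆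
      {ω | L ^ 2 < ‖X 0 ω‖ ^ 2 / d} ∪
      {ω | ∃ m ≤ 2 ^ N, η ≤ |invNormObservable d (X m ω) - invNormObservable d (X 0 ω)|} := by
    intro ω hω
    by_contra hcon
    simp only [mem_union, mem_ofPred_eq, not_or, not_lt, not_exists, not_and, not_le] at hcon hω
    have hosc := supOscillation_scaledSqNorm_le (T := T) (κ := δ / 4) ha
      (x := fun m => X m ω) fun m hm => abs_sub_le_of_abs_inv_sub_lt (by positivity)
        (by positivity) hcon.1 (hcon.2 m (hm.trans hN)) hη1 hη2
    have := hω.trans hosc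
    rw [ENNReal.ofReal_le_ofReal_iff (by positivity)] at this
    linarith
  refine (measure_mono hsub).trans ((measure_union_le _ _).trans (add_le_add hinit ?_))
  refine hmax.trans_eq ?_
  congr 1
  ring

/-! ### Choice of the time scale -/

theorem tendsto_sq_log_mul_rpow_neg {ε : ℝ} (hε : 0 < ε) :
    Tendsto (fun x : ℝ => 2 * (2 + 4 * Real.log x) ^ 2 * x ^ (-ε)) atTop (𝓝 0) := by
  have h1 : Tendsto (fun x : ℝ => Real.log x / x ^ (ε / 2)) atTop (𝓝 0) :=
    (isLittleO_log_rpow_atTop (half_pos hε)).tendsto_div_nhds_zero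
  have h2 : Tendsto (fun x : ℝ => x ^ (-(ε / 2))) atTop (𝓝 0) :=
    tendsto_rpow_neg_atTop (half_pos hε)
  have h3 := (((h2.const_mul 2).add (h1.const_mul 4)).pow 2).const_mul 2
  simp only [mul_zero, add_zero, ne_eq, OfNat.ofNat_ne_zero, not_false_eq_true, zero_pow] at h3
  refine h3.congr' ?_
  filter_upwards [eventually_gt_atTop 0] with x hx
  have e : x ^ (-ε) = x ^ (-(ε / 2)) * x ^ (-(ε / 2)) := by
    rw [← Real.rpow_add hx]; congr 1; ring
  rw [e, Real.rpow_neg hx.le]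
  ring

/-- The number of steps up to time `T` is at most `2 ^ N d`, where `2 ^ N d` is `o(d ^ 2)` even
after multiplication by the logarithmic loss `(N d + 1) ^ 2` of the chaining bound. -/
theorem exists_dyadic_time_scale {α : ℕ → ℝ} {ε : ℝ} (hε : 0 < ε)
    (hα : Tendsto (fun d : ℕ => α d / (d : ℝ) ^ (2 - ε)) atTop (𝓝 0)) (T : ℝ) :
    ∃ N : ℕ → ℕ, (∀ᶠ d in atTop, ⌊T * α d⌋₊ ≤ 2 ^ N d) ∧
      Tendsto (fun d : ℕ => ((N d : ℝ) + 1) ^ 2 * 2 ^ N d / (d : ℝ) ^ 2) atTop (𝓝 0) := by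
  -- An exponent `2 - ε < 0` would make `d ^ (2 - ε)` decay; `ε` may be decreased.
  set e := min ε 1 with he
  have he0 : 0 < e := lt_min hε one_pos
  set n : ℕ → ℕ := fun d => ⌊(d : ℝ) ^ (2 - e)⌋₊ with hn
  refine ⟨fun d => Nat.log 2 (n d) + 1, ?_, ?_⟩
  · have h1 := (hα.const_mul T).eventually_lt_const (u := 1) (by simp)
    filter_upwards [h1, eventually_ge_atTop 1] with d hd hd1
    have hd1' : (1 : ℝ) ≤ d := by exact_mod_cast hd1
    have hd0 : (0 : ℝ) < d := by linarith
    refine le_trans ?_ (Nat.lt_pow_succ_log_self one_lt_two (n d)).le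
    refine Nat.floor_le_floor ?_
    rw [← mul_div_assoc, div_lt_one (by positivity)] at hd
    exact hd.le.trans (Real.rpow_le_rpow_of_exponent_le hd1' (by linarith [min_le_left ε 1]))
  · refine squeeze_zero' (Eventually.of_forall fun d => by positivity) ?_
      ((tendsto_sq_log_mul_rpow_neg he0).comp tendsto_natCast_atTop_atTop)
    filter_upwards [eventually_ge_atTop 1] with d hd1
    have hd1' : (1 : ℝ) ≤ d := by exact_mod_cast hd1
    have hd0 : (0 : ℝ) < d := by linarith
    have hlog0 : 0 ≤ Real.log d := Real.log_nonneg hd1'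
    have hone : (1 : ℝ) ≤ (d : ℝ) ^ (2 - e) :=
      Real.one_le_rpow hd1' (by linarith [min_le_right ε 1])
    have hn0 : n d ≠ 0 := (Nat.floor_pos.2 hone).ne'
    have hpow : (2 : ℝ) ^ Nat.log 2 (n d) ≤ (d : ℝ) ^ (2 - e) := by
      have h1 : ((2 ^ Nat.log 2 (n d) : ℕ) : ℝ) ≤ n d := by
        exact_mod_cast Nat.pow_log_le_self 2 hn0
      push_cast at h1
      exact h1.trans (Nat.floor_le (by positivity))
    have hlog : (Nat.log 2 (n d) : ℝ) ≤ 4 * Real.log d := by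
      have h1 := Real.log_le_log (by positivity) hpow
      rw [Real.log_pow, Real.log_rpow hd0] at h1
      have h2 := Real.log_two_gt_d9
      have h3 : (0 : ℝ) ≤ Nat.log 2 (n d) := Nat.cast_nonneg _
      nlinarith
    simp only [Function.comp_apply]
    have e1 : (d : ℝ) ^ (-e) = (d : ℝ) ^ (2 - e) / (d : ℝ) ^ 2 := by
      rw [← Real.rpow_natCast, ← Real.rpow_sub hd0]
      congr 1; push_cast; ring
    rw [e1, ← mul_div_assoc]
    refine div_le_div_of_nonneg_right ?_ (by positivity)
    calc _ ≤ (2 + 4 * Real.log d) ^ 2 * (2 * (d : ℝ) ^ (2 - e)) := by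
          refine mul_le_mul ?_ ?_ (by positivity) (by positivity)
          · push_cast
            exact pow_le_pow_left₀ (by positivity) (by linarith) 2
          · rw [pow_succ]; linarith
      _ = _ := by ring

theorem proposition2
    (Q : Measure ℝ) [IsProbabilityMeasure Q] (hQ : IsAdmissibleMixing Q)
    (Γ : ∀ d : ℕ, Measure (EuclideanSpace ℝ (Fin d))) [∀ d, IsProbabilityMeasure (Γ d)]
    (hΓ : ∀ d, ∀ A : Set (EuclideanSpace ℝ (Fin d)), MeasurableSet A → Γ d A = Γ d (-A))
    (α : ℕ → ℝ) (hα_nonneg : ∀ d, 0 ≤ α d)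
    (ε : ℝ) (hε : 0 < ε)
    (hα : Tendsto (fun d : ℕ => α d / (d : ℝ) ^ (2 - ε)) atTop (𝓝 0))
    {Ω : ℕ → Type*} [∀ d, MeasurableSpace (Ω d)]
    (μ : ∀ d, Measure (Ω d)) [∀ d, IsProbabilityMeasure (μ d)]
    (X W : ∀ d : ℕ, ℕ → Ω d → EuclideanSpace ℝ (Fin d)) (U : ∀ d : ℕ, ℕ → Ω d → ℝ)
    (hX : ∀ d, 1 ≤ d → IsStationaryRWM Q d (Γ d) (μ d) (X d) (W d) (U d))
    (T : ℝ) (hT : 0 ≤ T) (δ : ℝ) (hδ : 0 < δ) :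
    Tendsto
      (fun d : ℕ => μ d {ω | ENNReal.ofReal δ ≤
        supOscillation (scaledSqNorm (α d) (fun m => X d m ω)) T})
      atTop (𝓝 0) := by
  obtain ⟨N, hN, hNlim⟩ := exists_dyadic_time_scale hε hα T
  rw [ENNReal.tendsto_nhds_zero]
  intro θ hθ
  have hθ2 : 0 < θ / 2 := ENNReal.half_pos hθ.ne'
  -- The truncation level of the initial state is chosen before the dimension grows.
  have htail : Tendsto (fun L : ℝ => Q (Ioi L) + ENNReal.ofReal L⁻¹) atTop (𝓝 0) := by
    have := (tendsto_measure_Ioi_atTop Q).add (ENNReal.tendsto_ofReal tendsto_inv_atTop_zero)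
    simpa using this
  obtain ⟨L, hL, hL0⟩ := ((ENNReal.tendsto_nhds_zero.1 htail (θ / 2) hθ2).and
    (eventually_gt_atTop 0)).exists
  set η := min (2 * (1 + L ^ 2))⁻¹ (δ / 4 / (2 * (1 + L ^ 2) ^ 2)) with hη
  have hη0 : 0 < η := lt_min (by positivity) (by positivity)
  have hmain : Tendsto (fun d : ℕ => ENNReal.ofReal (((N d : ℝ) + 1) ^ 2 * 2 ^ N d / (d : ℝ) ^ 2 *
      (2 * gaussianFourthMoment.toReal / η ^ 2))) atTop (𝓝 0) := by
    have := ENNReal.tendsto_ofReal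
      (hNlim.mul_const (2 * gaussianFourthMoment.toReal / η ^ 2))
    simpa using this
  filter_upwards [hN, ENNReal.tendsto_nhds_zero.1 hmain (θ / 2) hθ2, eventually_ge_atTop 1]
    with d hd1 hd2 hd
  calc _ ≤ _ := (hX d hd).measure_supOscillation_ge_le hQ.ae_pos hd (hΓ d) (hα_nonneg d) hδ hL0
        hη0 (min_le_left _ _) (min_le_right _ _) hd1
    _ ≤ θ / 2 + θ / 2 := add_le_add hL hd2
    _ = θ := ENNReal.add_halves θ
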